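/- **Setting.** Let $P_1(\mathbb R)$ be the real projective line with projective coordinate $x$ and angular coordinate $\rho\in\mathbb R/2\pi\mathbb Z$, $x=\cot(\rho/2)$; let $\mathcal P=P_1(\mathbb R)\times P_1(\mathbb R)$, with angular coordinates $(\rho,\sigma)$ and the measure $d\lambda=d\rho\,d\sigma$. The group $SL(2,\mathbb R)\times SL(2,\mathbb R)$ acts on real functions $\phi\in L^2(\mathcal P,\lambda,\mathbb R)$ by $$(T'(g,h)\phi)(x,y)=k_g(x)^{-3}s_g(x)\,k_h(y)^{-3}s_h(y)\,\phi(xg,yh),$$ where for $g=\begin{pmatrix}a&b\\c&d\end{pmatrix}$ $$xg=\frac{xa+c}{xb+d},\qquad k_g(x)=\Big(\frac{(xb+d)^2+(xa+c)^2}{1+x^2}\Big)^{1/2},\qquad s_g(x)=\frac{xb+d}{|xb+d|}.$$ For a subgroup $S$ let $A(S)=\{\phi\in L^2(\mathcal P,\lambda,\mathbb R): T'(s)\phi=\phi\ \text{for all } s\in S\}$. With $R(\theta)=\begin{pmatrix}\cos\theta&\sin\theta\\-\sin\theta&\cos\theta\end{pmatrix}$ put $$H(N,a,b)=\{(R(a\theta),\,R(b\theta+2\pi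 j/N)):\theta\in\mathbb R,\ j=0,\dots,N-1\}\subset SO(2)\times SO(2),$$ and let $\varsigma(t)=\sin t/|\sin t|$. **Theorem.** Let $N,q_o,p_o$ be odd positive integers with $q_o,p_o$ coprime, and put $\mathrm q=p_o/q_o$. For $i=1,2,3,4$ let the group $H_i$, the coordinates $u_i,v_i$, the sign $\varepsilon_i$ and the integer $N'=N'_i$ be 1. $H_1=H(N,q_o,p_o)$, $u_1=\sigma-\mathrm q\rho$, $v_1=\mathrm q\sigma+\rho$, $\varepsilon_1=\varsigma(-\tfrac{\rho}{2})\varsigma(\tfrac{\sigma}{2})$, $N'=N/\gcd(N,q_o)$; 2. $H_2=H(N,p_o,q_o)$, $u_2=\rho-\mathrm q\sigma$, $v_2=\mathrm q\rho+\sigma$, $\varepsilon_2=\varsigma(-\tfrac{\sigma}{2})\varsigma(\tfrac{\rho}{2})$, $N'=N/\gcd(N,p_o)$; 3. $H_3=H(N,-q_o,p_o)$, $u_3=\sigma+\mathrm q\rho$, $v_3=\mathrm q\sigma-\rho$, $\varepsilon_3=\varsigma(\tfrac{\sigma}{2})\varsigma(\tfrac{\rho}{2})$, $N'=N/\gcd(N,q_o)$;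 4. $H_4=H(N,-p_o,q_o)$, $u_4=-\rho-\mathrm q\sigma$, $v_4=\sigma-\mathrm q\rho$, $\varepsilon_4=\varsigma(\tfrac{\sigma}{2})\varsigma(\tfrac{\rho}{2})$, $N'=N/\gcd(N,p_o)$. Let $L_i=2\pi/(q_oN'_i)$. Then for each $i$: * $A(H_i)\neq 0$. * A function $\phi\in L^2(\mathcal P,\lambda,\mathbb R)$ belongs to $A(H_i)$ if and only if, for almost every $(\rho,\sigma)\in\mathbb R^2$, $\phi(\rho,\sigma)=\varepsilon_i(\rho,\sigma)\,\vartheta(u_i(\rho,\sigma))$ for some $\vartheta:\mathbb R\to\mathbb R$ with $\vartheta(u+L_i)=-\vartheta(u)$ for all $u$ and $\vartheta|_{[0,L_i]}\in L^2([0,L_i],du)$; and every such $\vartheta$ arises from some $\phi \in A(H_i)$. * Let $A_i$ be the arc $v_i=0$, $0\le u_i\le L_i$ on the torus $\mathcal P$, on which $u_i$ is an injective parameter, with the Lebesgue measure $du_i$. Then $A(H_i)$ is isomorphic as a Hilbert space to $L^2(A_i,du_i,\mathbb R)$. More precisely, there is a linear isometric isomorphism of $L^2(A_i,du_i,\mathbb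 R)$ onto $A(H_i)$ sending $f$ to $\phi=(2\pi q_oN'_i)^{-1/2}\,\varepsilon_i\,\vartheta(u_i)$, where $\vartheta$ is antiperiodic with period $L_i$ and agrees almost everywhere on $[0,L_i]$ with $f$ as a function of $u_i$. -/

import Mathlib

open MeasureTheory Matrix
open scoped MatrixGroups

noncomputable section

namespace UHBMS

/-! ### The projective line, the torus and their measures -/

/-- The real projective line `P₁(ℝ) = ℝ ∪ {∞}`, in the projective coordinate `x = x₁ / x₂`. -/
abbrev P1 : Type := OnePoint ℝ

instance instMeasurableSpaceP1 : MeasurableSpace P1 := borel P1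

instance instBorelSpaceP1 : BorelSpace P1 := ⟨rfl⟩

/-- The torus `P₁(ℝ) × P₁(ℝ)`. -/
abbrev Torus : Type := P1 × P1

/-- The point of `P₁(ℝ)` with angular coordinate `ρ`, that is `x = cot (ρ / 2)`
(and `x = ∞` when `ρ ∈ 2πℤ`). -/
def angPt (ρ : ℝ) : P1 :=
  if Real.sin (ρ / 2) = 0 then OnePoint.infty else ((Real.cot (ρ / 2) : ℝ) : P1)

/-- The point of the torus with angular coordinates `(ρ, σ)`. -/
def torusPt (z : ℝ × ℝ) : Torus := (angPt z.1, angPt z.2)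

/-- The rotation invariant measure `dρ` on `P₁(ℝ)`, where `0 < ρ ≤ 2π`. -/
def lam1 : Measure P1 := (volume.restrict (Set.Ioc 0 (2 * Real.pi))).map angPt

/-- The measure `dρ dσ` on the torus. -/
def lam : Measure Torus := lam1.prod lam1

lemma measurable_coe : Measurable ((↑) : ℝ → P1) := OnePoint.continuous_coe.measurable

lemma measurableEmbedding_coe : MeasurableEmbedding ((↑) : ℝ → P1) :=
  OnePoint.isOpenEmbedding_coe.measurableEmbedding

lemma measurable_cot : Measurable Real.cot := by
  have : Real.cot = fun x => Real.cos x / Real.sin x := by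
    funext x; exact Real.cot_eq_cos_div_sin x
  rw [this]
  fun_prop

lemma measurable_angPt : Measurable angPt := by
  unfold angPt
  refine Measurable.ite ?_ measurable_const
    (measurable_coe.comp (measurable_cot.comp (measurable_id.div_const 2)))
  exact (measurableSet_singleton (0 : ℝ)).preimage
    (Real.measurable_sin.comp (measurable_id.div_const 2))

lemma measurable_torusPt : Measurable torusPt :=
  (measurable_angPt.comp measurable_fst).prodMk (measurable_angPt.comp measurable_snd)

instance instIsFiniteMeasureLam1 : IsFiniteMeasure lam1 := by
  unfold lam1
  infer_instance

/-- A function out of `P₁(ℝ)` is measurable as soon as it is so on the affine line. -/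
lemma measurable_of_coe {β : Type*} [MeasurableSpace β] {f : P1 → β}
    (hf : Measurable fun x : ℝ => f x) : Measurable f := by
  intro s hs
  have h1 : f ⁻¹' s = ((↑) : ℝ → P1) '' ((fun x : ℝ => f x) ⁻¹' s) ∪
      (f ⁻¹' s ∩ {OnePoint.infty}) := by
    ext x
    induction x using OnePoint.rec with
    | infty => simp
    | coe x => simp
  rw [h1]
  refine (measurableEmbedding_coe.measurableSet_image.2 (hf hs)).union ?_
  exact (Set.subsingleton_singleton.anti Set.inter_subset_right).measurableSet

/-! ### The action of `SL(2,ℝ) × SL(2,ℝ)` -/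

/-- The group `SL(2,ℝ) × SL(2,ℝ)`. -/
abbrev GG : Type := SL(2, ℝ) × SL(2, ℝ)

/-- The right action `x g = (x a + c) / (x b + d)` on `P₁(ℝ)`, for `g` with rows `(a, b)`, `(c, d)`,
as the Möbius action of the transposed matrix. -/
def moeb (g : SL(2, ℝ)) (x : P1) : P1 := (g.transpose : GL (Fin 2) ℝ) • x

/-- `xg` is given by the usual formula. -/
lemma moeb_coe (g : SL(2, ℝ)) (x : ℝ) :
    moeb g x = if x * g 0 1 + g 1 1 = 0 then OnePoint.infty
      else (((x * g 0 0 + g 1 0) / (x * g 0 1 + g 1 1) : ℝ) : P1) := by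
  unfold moeb
  rw [OnePoint.smul_some_eq_ite]
  simp [mul_comm]

/-- The factor `k_g(x)`; at `x = ∞` (a null set) its limit. -/
def kFac (g : SL(2, ℝ)) (x : P1) : ℝ :=
  x.elim (Real.sqrt (g 0 0 ^ 2 + g 0 1 ^ 2))
    (fun x : ℝ => Real.sqrt (((x * g 0 1 + g 1 1) ^ 2 + (x * g 0 0 + g 1 0) ^ 2) / (1 + x ^ 2)))

/-- The factor `s_g(x) = (x b + d) / |x b + d|`; the value at `x = ∞` (a null set) is a
convention. -/
def sFac (g : SL(2, ℝ)) (x : P1) : ℝ :=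
  x.elim (g 0 1 / |g 0 1|) (fun x : ℝ => (x * g 0 1 + g 1 1) / |x * g 0 1 + g 1 1|)

/-- The dual action
`(T'(g,h) φ)(x,y) = k_g(x)⁻³ s_g(x) k_h(y)⁻³ s_h(y) φ(xg, yh)` on functions on the torus. -/
def dualAct (k : GG) (φ : Torus → ℝ) (z : Torus) : ℝ :=
  (kFac k.1 z.1 ^ 3)⁻¹ * sFac k.1 z.1 * ((kFac k.2 z.2 ^ 3)⁻¹ * sFac k.2 z.2) *
    φ (moeb k.1 z.1, moeb k.2 z.2)

/-! ### Null sets are respected by the action -/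

lemma measurable_moeb (g : SL(2, ℝ)) : Measurable (moeb g) := by
  refine measurable_of_coe ?_
  simp_rw [moeb_coe]
  refine Measurable.ite ?_ measurable_const (measurable_coe.comp (by fun_prop))
  exact (measurableSet_singleton (0 : ℝ)).preimage
    (by fun_prop : Measurable fun x : ℝ => x * g 0 1 + g 1 1)

lemma lam1_null_iff {B : Set P1} (hB : MeasurableSet B) :
    lam1 B = 0 ↔ volume (((↑) : ℝ → P1) ⁻¹' B) = 0 := by
  have hpi := Real.pi_pos
  unfold lam1
  rw [Measure.map_apply measurable_angPt hB, Measure.restrict_apply (measurable_angPt hB)]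
  constructor
  · intro h
    -- the affine part of `B` is the image of the angular set under `cot (ρ / 2)`
    have h0 : volume (angPt ⁻¹' B ∩ Set.Ioo 0 (2 * Real.pi)) = 0 :=
      measure_mono_null (Set.inter_subset_inter_right _ Set.Ioo_subset_Ioc_self) h
    have hd : DifferentiableOn ℝ (fun ρ => Real.cos (ρ / 2) / Real.sin (ρ / 2))
        (angPt ⁻¹' B ∩ Set.Ioo 0 (2 * Real.pi)) := by
      intro ρ hρ
      have : Real.sin (ρ / 2) ≠ 0 :=
        (Real.sin_pos_of_pos_of_lt_pi (by linarith [hρ.2.1]) (by linarith [hρ.2.2])).ne'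
      refine DifferentiableAt.differentiableWithinAt ?_
      fun_prop (disch := assumption)
    refine measure_mono_null ?_
      (addHaar_image_eq_zero_of_differentiableOn_of_addHaar_eq_zero volume hd h0)
    intro x hx
    have hx1 := Real.arctan_lt_pi_div_two x
    have hx2 := Real.neg_pi_div_two_lt_arctan x
    have hc : (2 * (Real.pi / 2 - Real.arctan x)) / 2 = Real.pi / 2 - Real.arctan x := by ring
    have hs : Real.sin (Real.pi / 2 - Real.arctan x) ≠ 0 := by
      rw [Real.sin_pi_div_two_sub]; exact (Real.cos_arctan_pos x).ne'
    have hv : Real.cos (Real.pi / 2 - Real.arctan x) / Real.sin (Real.pi / 2 - Real.arctan x)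
        = x := by
      rw [Real.sin_pi_div_two_sub, Real.cos_pi_div_two_sub, ← Real.tan_eq_sin_div_cos,
        Real.tan_arctan]
    refine ⟨2 * (Real.pi / 2 - Real.arctan x), ⟨?_, ?_, ?_⟩, ?_⟩
    · change angPt _ ∈ B
      unfold angPt
      rw [hc, if_neg hs, Real.cot_eq_cos_div_sin, hv]
      exact hx
    · linarith
    · linarith
    · simp only [hc, hv]
  · intro h
    have hd : DifferentiableOn ℝ (fun x => 2 * (Real.pi / 2 - Real.arctan x))
        (((↑) : ℝ → P1) ⁻¹' B) := fun x _ =>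
      DifferentiableAt.differentiableWithinAt
        (((differentiableAt_const _).sub (Real.differentiableAt_arctan x)).const_mul 2)
    have h1 := addHaar_image_eq_zero_of_differentiableOn_of_addHaar_eq_zero volume hd h
    refine measure_mono_null ?_ (measure_union_null h1 (measure_singleton (2 * Real.pi)))
    rintro ρ ⟨hρB, hρ0, hρ1⟩
    rcases hρ1.eq_or_lt with rfl | hlt
    · exact Or.inr rfl
    left
    have hs : Real.sin (ρ / 2) ≠ 0 :=
      (Real.sin_pos_of_pos_of_lt_pi (by linarith) (by linarith)).ne'
    have hρB' : angPt ρ ∈ B := hρB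
    unfold angPt at hρB'
    rw [if_neg hs] at hρB'
    refine ⟨Real.cot (ρ / 2), hρB', ?_⟩
    have ht : Real.cot (ρ / 2) = Real.tan (Real.pi / 2 - ρ / 2) := by
      rw [Real.tan_pi_div_two_sub, Real.cot_eq_cos_div_sin, Real.tan_eq_sin_div_cos, inv_div]
    simp only [ht]
    rw [Real.arctan_tan (by linarith) (by linarith)]
    ring

lemma quasiMeasurePreserving_moeb (g : SL(2, ℝ)) :
    Measure.QuasiMeasurePreserving (moeb g) lam1 lam1 := by
  refine ⟨measurable_moeb g, Measure.AbsolutelyContinuous.mk fun B hB h => ?_⟩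
  rw [Measure.map_apply (measurable_moeb g) hB, lam1_null_iff (measurable_moeb g hB)]
  rw [lam1_null_iff hB] at h
  have hdet : g 0 0 * g 1 1 - g 0 1 * g 1 0 = 1 := by
    have := g.det_coe
    rwa [Matrix.det_fin_two] at this
  have hd : DifferentiableOn ℝ (fun y : ℝ => (y * g 1 1 - g 1 0) / (g 0 0 - y * g 0 1))
      (((↑) : ℝ → P1) ⁻¹' B ∩ {y | g 0 0 - y * g 0 1 ≠ 0}) := by
    intro y hy
    have : g 0 0 - y * g 0 1 ≠ 0 := hy.2
    refine DifferentiableAt.differentiableWithinAt ?_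
    fun_prop (disch := assumption)
  have h1 := addHaar_image_eq_zero_of_differentiableOn_of_addHaar_eq_zero volume hd
    (measure_mono_null Set.inter_subset_left h)
  refine measure_mono_null ?_
    (measure_union_null h1 (measure_singleton (-(g 1 1) / g 0 1)))
  intro x hx
  have hx' : moeb g x ∈ B := hx
  rw [moeb_coe] at hx'
  split_ifs at hx' with h0
  · right
    have hb : g 0 1 ≠ 0 := by
      intro hb
      simp only [hb, mul_zero, zero_add, zero_mul, sub_zero] at h0 hdet
      rw [h0, mul_zero] at hdet
      exact zero_ne_one hdet
    rw [Set.mem_singleton_iff, eq_div_iff hb]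
    linarith
  · left
    have hden : g 0 0 - (x * g 0 0 + g 1 0) / (x * g 0 1 + g 1 1) * g 0 1
        = 1 / (x * g 0 1 + g 1 1) := by
      field_simp
      linear_combination hdet
    refine ⟨(x * g 0 0 + g 1 0) / (x * g 0 1 + g 1 1), ⟨hx', ?_⟩, ?_⟩
    · change g 0 0 - _ ≠ 0
      rw [hden]
      exact one_div_ne_zero h0
    · simp only
      rw [hden]
      field_simp
      linear_combination x * hdet

lemma quasiMeasurePreserving_act (k : GG) :
    Measure.QuasiMeasurePreserving (fun z : Torus => (moeb k.1 z.1, moeb k.2 z.2)) lam lam :=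
  MeasureTheory.QuasiMeasurePreserving.prodMap (quasiMeasurePreserving_moeb k.1)
    (quasiMeasurePreserving_moeb k.2)

lemma dualAct_congr (k : GG) {φ ψ : Torus → ℝ} (h : φ =ᵐ[lam] ψ) :
    dualAct k φ =ᵐ[lam] dualAct k ψ := by
  filter_upwards [(quasiMeasurePreserving_act k).ae h] with z hz
  simp only [dualAct, hz]

/-! ### Invariant functions -/

/-- The real Hilbert space `L²(P₁(ℝ) × P₁(ℝ), λ, ℝ)`, identified with its dual. -/
abbrev L2Torus : Type := Lp ℝ 2 lam

/-- The space `A(S)` of all `φ` with `T'(g,h) φ = φ` for all `(g,h) ∈ S`. -/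
def fixedSpace (S : Subgroup GG) : Submodule ℝ L2Torus where
  carrier := {φ | ∀ k ∈ S, dualAct k φ =ᵐ[lam] φ}
  zero_mem' := by
    intro k _
    refine (dualAct_congr k (Lp.coeFn_zero ℝ 2 lam)).trans ?_
    filter_upwards [Lp.coeFn_zero ℝ 2 lam] with z hz
    refine Eq.trans ?_ hz.symm
    simp [dualAct]
  add_mem' := by
    intro φ ψ hφ hψ k hk
    refine (dualAct_congr k (Lp.coeFn_add φ ψ)).trans ?_
    filter_upwards [Lp.coeFn_add φ ψ, hφ k hk, hψ k hk] with z hz h1 h2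
    rw [hz, Pi.add_apply, ← h1, ← h2]
    simp only [dualAct, Pi.add_apply]
    ring
  smul_mem' := by
    intro c φ hφ k hk
    refine (dualAct_congr k (Lp.coeFn_smul c φ)).trans ?_
    filter_upwards [Lp.coeFn_smul c φ, hφ k hk] with z hz h1
    rw [hz, Pi.smul_apply, ← h1]
    simp only [dualAct, Pi.smul_apply, smul_eq_mul]
    ring

/-! ### The subgroups `H(N, q, p)` of `SO(2) × SO(2)` -/

/-- The rotation matrix with rows `(cos θ, sin θ)` and `(-sin θ, cos θ)`. -/
def rot (θ : ℝ) : SL(2, ℝ) :=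
  ⟨!![Real.cos θ, Real.sin θ; -Real.sin θ, Real.cos θ], by
    rw [Matrix.det_fin_two_of]; nlinarith [Real.sin_sq_add_cos_sq θ]⟩

lemma rot_zero : rot 0 = 1 := by
  ext i j; fin_cases i <;> fin_cases j <;> simp [rot]

lemma rot_mul (α β : ℝ) : rot α * rot β = rot (α + β) := by
  apply Subtype.ext
  rw [Matrix.SpecialLinearGroup.coe_mul]
  simp only [rot, Matrix.mul_fin_two, Real.cos_add, Real.sin_add]
  ext i j
  fin_cases i <;> fin_cases j <;> simp <;> ring

lemma rot_inv (α : ℝ) : (rot α)⁻¹ = rot (-α) := by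
  rw [inv_eq_iff_mul_eq_one, rot_mul, add_neg_cancel, rot_zero]

/-- `H(N,q,p)`: all pairs `(R(qθ), R(pθ + 2πj/N))` with `θ` real and `j` an integer
(only `j` modulo `N` matters). -/
def grpH (N : ℕ) (q p : ℤ) : Subgroup GG where
  carrier := {k | ∃ (θ : ℝ) (j : ℤ), k = (rot (q * θ), rot (p * θ + 2 * Real.pi / N * j))}
  one_mem' := ⟨0, 0, by simp only [Int.cast_zero, mul_zero, add_zero, rot_zero]; rfl⟩
  mul_mem' := by
    rintro _ _ ⟨θ, j, rfl⟩ ⟨θ', j', rfl⟩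
    refine ⟨θ + θ', j + j', ?_⟩
    rw [Prod.mk_mul_mk, rot_mul, rot_mul]
    push_cast
    congr 2 <;> ring
  inv_mem' := by
    rintro _ ⟨θ, j, rfl⟩
    refine ⟨-θ, -j, ?_⟩
    rw [Prod.inv_mk, rot_inv, rot_inv]
    push_cast
    congr 2 <;> ring

/-! ### The four families -/

/-- The four groups `H(N,q,p)`, `H(N,p,q)`, `H(N,-q,p)`, `H(N,-p,q)`. -/
def family (N q p : ℕ) : Fin 4 → Subgroup GG :=
  ![grpH N q p, grpH N p q, grpH N (-q) p, grpH N (-p) q]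

/-- `N' = N / gcd(N, q)` in the first and third case, `N' = N / gcd(N, p)` in the second and
fourth. -/
def Nred (N q p : ℕ) : Fin 4 → ℕ :=
  ![N / N.gcd q, N / N.gcd p, N / N.gcd q, N / N.gcd p]

/-- The arc length `2π / (q N')`. -/
def arcLen (N q p : ℕ) (i : Fin 4) : ℝ := 2 * Real.pi / (q * Nred N q p i)

/-- The coordinates `u₁, …, u₄` (where `𝐪 = p / q`), as functions of `z = (ρ, σ)`. -/
def uCoord (q p : ℕ) : Fin 4 → ℝ × ℝ → ℝ :=
  ![fun z => z.2 - (p / q : ℝ) * z.1, fun z => z.1 - (p / q : ℝ) * z.2,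
    fun z => z.2 + (p / q : ℝ) * z.1, fun z => -z.1 - (p / q : ℝ) * z.2]

/-- The coordinates `v₁, …, v₄`, as functions of `z = (ρ, σ)`. -/
def vCoord (q p : ℕ) : Fin 4 → ℝ × ℝ → ℝ :=
  ![fun z => (p / q : ℝ) * z.2 + z.1, fun z => (p / q : ℝ) * z.1 + z.2,
    fun z => (p / q : ℝ) * z.2 - z.1, fun z => z.2 - (p / q : ℝ) * z.1]

/-- `ς(t) = sin t / |sin t|`. -/
def sgnSin (t : ℝ) : ℝ := Real.sin t / |Real.sin t|

/-- The sign factors in front of `ϑ`, as functions of `z = (ρ, σ)`. -/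
def signFac : Fin 4 → ℝ × ℝ → ℝ :=
  ![fun z => sgnSin (-z.1 / 2) * sgnSin (z.2 / 2), fun z => sgnSin (-z.2 / 2) * sgnSin (z.1 / 2),
    fun z => sgnSin (z.2 / 2) * sgnSin (z.1 / 2), fun z => sgnSin (z.2 / 2) * sgnSin (z.1 / 2)]

/-- The function `φ` on the torus has the form `signFac · ϑ(uᵢ)`, almost everywhere in the angular
coordinates `(ρ, σ)`. -/
def HasForm (q p : ℕ) (i : Fin 4) (φ : Torus → ℝ) (ϑ : ℝ → ℝ) : Prop :=
  ∀ᵐ z : ℝ × ℝ, φ (torusPt z) = signFac i z * ϑ (uCoord q p i z)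

/-- `ϑ` is real valued, antiperiodic with period `L` and square integrable on `[0, L]`. -/
def IsTheta (L : ℝ) (ϑ : ℝ → ℝ) : Prop :=
  Function.Antiperiodic ϑ L ∧ MemLp ϑ 2 (volume.restrict (Set.Icc 0 L))

/-- The point `(ρ, σ)` with `uᵢ = u` and `vᵢ = 0`. -/
def arcCoord (q p : ℕ) (i : Fin 4) (u : ℝ) : ℝ × ℝ :=
  let r : ℝ := p / q
  (![(-(r * u), u), (u, -(r * u)), (r * u, u), (-u, -(r * u))] i : ℝ × ℝ) |>.map
    (· / (1 + r ^ 2)) (· / (1 + r ^ 2))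

lemma arcCoord_iff (q p : ℕ) (i : Fin 4) (u : ℝ) (z : ℝ × ℝ) :
    z = arcCoord q p i u ↔ uCoord q p i z = u ∧ vCoord q p i z = 0 := by
  obtain ⟨x, y⟩ := z
  have h : (1 + (p / q : ℝ) ^ 2) ≠ 0 := by positivity
  fin_cases i <;>
    simp only [arcCoord, uCoord, vCoord, Prod.map, Prod.mk.injEq, eq_div_iff h, Fin.zero_eta,
      Fin.mk_one, Fin.reduceFinMk, Matrix.cons_val] <;>
    generalize (p / q : ℝ) = r at *
  · refine ⟨fun ⟨h1, h2⟩ => ⟨mul_left_cancel₀ h ?_, mul_left_cancel₀ h ?_⟩,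
      fun ⟨h1, h2⟩ => ⟨?_, ?_⟩⟩
    · linear_combination h2 - r * h1
    · linear_combination r * h2 + h1
    · linear_combination h2 - r * h1
    · linear_combination h1 + r * h2
  · refine ⟨fun ⟨h1, h2⟩ => ⟨mul_left_cancel₀ h ?_, mul_left_cancel₀ h ?_⟩,
      fun ⟨h1, h2⟩ => ⟨?_, ?_⟩⟩
    · linear_combination h1 - r * h2
    · linear_combination r * h1 + h2
    · linear_combination h1 + r * h2
    · linear_combination h2 - r * h1
  · refine ⟨fun ⟨h1, h2⟩ => ⟨mul_left_cancel₀ h ?_, mul_left_cancel₀ h ?_⟩,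
      fun ⟨h1, h2⟩ => ⟨?_, ?_⟩⟩
    · linear_combination h2 + r * h1
    · linear_combination r * h2 - h1
    · linear_combination r * h1 - h2
    · linear_combination h1 + r * h2
  · refine ⟨fun ⟨h1, h2⟩ => ⟨mul_left_cancel₀ h ?_, mul_left_cancel₀ h ?_⟩,
      fun ⟨h1, h2⟩ => ⟨?_, ?_⟩⟩
    · linear_combination -h1 - r * h2
    · linear_combination h2 - r * h1
    · linear_combination -h1 - r * h2
    · linear_combination h2 - r * h1

/-- The arc `vᵢ = 0`, `0 ≤ uᵢ ≤ 2π / (q N')` on the torus. -/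
def arc (N q p : ℕ) (i : Fin 4) : Set Torus :=
  torusPt '' {z | vCoord q p i z = 0 ∧ uCoord q p i z ∈ Set.Icc 0 (arcLen N q p i)}

lemma measurable_arcCoord (q p : ℕ) (i : Fin 4) : Measurable (arcCoord q p i) := by
  unfold arcCoord
  fin_cases i <;> simp only [Prod.map, Fin.zero_eta, Fin.mk_one, Fin.reduceFinMk,
    Matrix.cons_val] <;> fun_prop

/-- The point of the arc with coordinate `uᵢ = u`. -/
def arcPt (q p : ℕ) (i : Fin 4) (u : ℝ) : Torus := torusPt (arcCoord q p i u)

lemma measurable_arcPt (q p : ℕ) (i : Fin 4) : Measurable (arcPt q p i) :=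
  measurable_torusPt.comp (measurable_arcCoord q p i)

/-- `u ↦ arcPt u`, `0 ≤ u ≤ 2π / (q N')`, runs through the arc. -/
lemma arcPt_image (N q p : ℕ) (i : Fin 4) :
    arcPt q p i '' Set.Icc 0 (arcLen N q p i) = arc N q p i := by
  ext t
  constructor
  · rintro ⟨u, hu, rfl⟩
    obtain ⟨h1, h2⟩ := (arcCoord_iff q p i u _).1 rfl
    exact ⟨_, ⟨h2, by rwa [h1]⟩, rfl⟩
  · rintro ⟨z, ⟨hv, hu⟩, rfl⟩
    refine ⟨_, hu, ?_⟩
    rw [arcPt, ← (arcCoord_iff q p i _ z).2 ⟨rfl, hv⟩]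

/-- The Lebesgue measure `duᵢ` along the arc. -/
def arcMeasure (N q p : ℕ) (i : Fin 4) : Measure Torus :=
  (volume.restrict (Set.Icc 0 (arcLen N q p i))).map (arcPt q p i)

/-- The real Hilbert space of square integrable functions on the arc. -/
abbrev L2Arc (N q p : ℕ) (i : Fin 4) : Type := Lp ℝ 2 (arcMeasure N q p i)

end UHBMS
end

noncomputable section

namespace UHBMS

/-! ### Null sets on the line and in the plane -/

/-! In the angle `ρ` with `x = cot (ρ / 2)`, the rotation `rot α` is the translation `ρ ↦ ρ + 2α`.
Its factor `kFac` is 1, and its factor `sFac` is the quotient of the signs of `sin (ρ / 2)` after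
and before the translation. Multiplying `φ` by `sgn` therefore turns the action into pure
translation of `lift φ` (`dualAct_rot_ae_eq_iff`). The price is that `lift φ` is no longer periodic:
it changes by `(-1) ^ (k + l)` under the lattice vector `(2πk, 2πl)` (`lift_add`).

Invariance under the one-parameter part of the group makes `lift φ` a function `Θ` of the linear
form `a ρ + b σ` that this part preserves (`exists_linearForm_of_translation_invariant`). What
remains are the lattice and the translations by `(0, 4πj / N)`. The form takes the values `A L` and
`B L` on the two lattice generators, with `A`, `B` odd, and `C L` on `(0, 4π / N)`, with `C` even.
Hence the required signs are exactly those of an `L`-antiperiodic function. Since `L` itself is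
attained by a combination with `k + l` odd, antiperiodicity is also forced. `Resonant` records this
arithmetic, and `exists_resonant` checks it for the four families by a Bezout argument.

The norm comes from Fubini: for each fixed `ρ`, the form runs through a whole number of periods of
`ϑ ^ 2` as `σ` runs through a circle, so `‖φ‖ ^ 2` is `(2π) ^ 2 / L` times the integral of `ϑ ^ 2`
over `[0, L]` (`IsWave.norm_sq`). Restriction to an arc on which the form is an injective parameter
is then, up to a constant, the isometry (`exists_arc_isometry`). -/

/-- A `T`-periodic property that holds almost everywhere on one period holds almost everywhere. -/
lemma ae_of_ae_restrict_period {T : ℝ} (hT : 0 < T) {P : ℝ → Prop} (hP : ∀ x, P (x + T) ↔ P x)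
    (t : ℝ) (h : ∀ᵐ x ∂volume.restrict (Set.Ioc t (t + T)), P x) : ∀ᵐ x, P x := by
  have hper : Function.Periodic P T := fun x => propext (hP x)
  rw [ae_iff]
  refine (isAddFundamentalDomain_Ioc hT t).measure_zero_of_invariant _ ?_ ?_
  · rintro ⟨g, hg⟩
    obtain ⟨n, rfl⟩ := AddSubgroup.mem_zmultiples_iff.1 hg
    ext x
    rw [Set.mem_vadd_set_iff_neg_vadd_mem]
    change ¬ P (-(n • T) + x) ↔ ¬ P x
    rw [neg_add_eq_sub, hper.sub_zsmul_eq]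
  · rw [ae_iff, Measure.restrict_apply' measurableSet_Ioc] at h
    exact h

lemma measurePreserving_shear (c d e : ℝ) :
    MeasurePreserving (fun z : ℝ × ℝ => (z.1 + d, c * z.1 + e + z.2)) volume volume :=
  (measurePreserving_add_right volume d).skew_product (g := fun x y => c * x + e + y)
    (by unfold Function.uncurry; fun_prop)
    (Filter.Eventually.of_forall fun _ => map_add_left_eq_self _ _)

lemma quasiMeasurePreserving_affine {b : ℝ} (hb : b ≠ 0) (d : ℝ) :
    Measure.QuasiMeasurePreserving (fun x : ℝ => d + b * x) volume volume :=
  (measurePreserving_add_left volume d).quasiMeasurePreserving.comp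
    (Measure.quasiMeasurePreserving_smul volume hb)

lemma quasiMeasurePreserving_linearForm (a : ℝ) {b : ℝ} (hb : b ≠ 0) :
    Measure.QuasiMeasurePreserving (fun z : ℝ × ℝ => a * z.1 + b * z.2) volume volume := by
  have h := (quasiMeasurePreserving_affine hb 0).comp (Measure.quasiMeasurePreserving_snd.comp
    (measurePreserving_shear (a / b) 0 0).quasiMeasurePreserving)
  convert h using 2 with z
  simp only [Function.comp]
  field_simp
  ring

/-- A property of a nontrivial linear form in the plane that holds almost everywhere holds for
almost every value of the form. -/
lemma ae_of_ae_linearForm {a b : ℝ} (hb : b ≠ 0) {P : ℝ → Prop}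
    (h : ∀ᵐ z : ℝ × ℝ, P (a * z.1 + b * z.2)) : ∀ᵐ u, P u := by
  obtain ⟨x, hx⟩ := (Measure.ae_ae_of_ae_prod h).exists
  filter_upwards [(quasiMeasurePreserving_affine (inv_ne_zero hb) (-(a * x) / b)).ae hx] with u hu
  convert hu using 1
  field_simp
  ring

lemma ae_shift {P : ℝ × ℝ → Prop} (h : ∀ᵐ z, P z) (w : ℝ × ℝ) : ∀ᵐ z, P (z + w) :=
  (measurePreserving_add_right (volume : Measure (ℝ × ℝ)) w).quasiMeasurePreserving.ae h

/-- A measurable function in the plane that is invariant under a one parameter group of translations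
is a function of the linear form that this group preserves. -/
lemma exists_linearForm_of_translation_invariant {Ψ : ℝ × ℝ → ℝ} (hΨ : Measurable Ψ)
    {a b m n : ℝ} (hb : b ≠ 0) (hm : m ≠ 0) (hker : a * m + b * n = 0)
    (h : ∀ t : ℝ, ∀ᵐ z, Ψ (z + (t * m, t * n)) = Ψ z) :
    ∃ Θ : ℝ → ℝ, Measurable Θ ∧ ∀ᵐ z : ℝ × ℝ, Ψ z = Θ (a * z.1 + b * z.2) := by
  -- The null set in `h` depends on `t`; Fubini merges these into one null set in `(t, z)`, so that
  -- a base point can be fixed afterwards.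
  have h1 : ∀ᵐ w : ℝ × ℝ × ℝ, Ψ (w.2 + (w.1 * m, w.1 * n)) = Ψ w.2 := by
    rw [Measure.volume_eq_prod]
    refine (Measure.ae_prod_iff_ae_ae ?_).2 (Filter.Eventually.of_forall h)
    exact measurableSet_eq_fun (by fun_prop) (by fun_prop)
  have h2 : ∀ᵐ w : ℝ × ℝ × ℝ, Ψ (w.1 + w.2.1 * m, w.2.2 + w.2.1 * n) = Ψ (w.1, w.2.2) := by
    have e : MeasurePreserving (fun w : ℝ × ℝ × ℝ => (w.2.1, (w.1, w.2.2))) volume volume := by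
      have e1 : MeasurePreserving (fun w : ℝ × ℝ × ℝ => ((w.1, w.2.1), w.2.2)) volume volume :=
        (volume_preserving_prodAssoc (α₁ := ℝ) (β₁ := ℝ) (γ₁ := ℝ)).symm
      have e2 : MeasurePreserving (fun w : (ℝ × ℝ) × ℝ => (w.1.swap, w.2)) volume volume :=
        Measure.measurePreserving_swap.prod (MeasurePreserving.id volume)
      exact volume_preserving_prodAssoc.comp (e2.comp e1)
    filter_upwards [e.quasiMeasurePreserving.ae h1] with w hw
    exact hw
  obtain ⟨x, hx⟩ := (Measure.ae_ae_of_ae_prod h2).exists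
  -- `Θ u` is the value of `Ψ` at the point of the vertical line through a generic `x` where the
  -- form equals `u`; almost every point of the plane is carried there by the flow.
  refine ⟨fun u => Ψ (x, u / b - a / b * x), by fun_prop, ?_⟩
  have hx' : ∀ᵐ z : ℝ × ℝ, Ψ (x + z.1, z.2 + z.1 * (n / m)) = Ψ (x, z.2) := by
    have e : Measure.QuasiMeasurePreserving (fun z : ℝ × ℝ => (z.1 / m, z.2)) volume volume := by
      have e1 : Measure.QuasiMeasurePreserving (fun y : ℝ => y / m) volume volume := by
        convert quasiMeasurePreserving_affine (inv_ne_zero hm) 0 using 2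
        ring
      exact MeasureTheory.QuasiMeasurePreserving.prodMap e1 (Measure.QuasiMeasurePreserving.id _)
    filter_upwards [e.ae hx] with z hz
    convert hz using 3 <;> field_simp
  filter_upwards [(measurePreserving_shear (-(n / m)) (-x) (n / m * x)).quasiMeasurePreserving.ae
    hx'] with z hz
  convert hz using 2
  · ext <;> simp only <;> ring
  · ext
    · rfl
    · have : n = -(a * m) / b := by field_simp; linear_combination hker
      subst this
      field_simp
      ring

/-! ### Antiperiodic functions -/

/-- The antiperiodic function that agrees with `f` on `[0, L)`. -/
def antiExt (L : ℝ) (f : ℝ → ℝ) (u : ℝ) : ℝ := (-1) ^ ⌊u / L⌋ * f (u - ⌊u / L⌋ * L)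

lemma antiExt_antiperiodic {L : ℝ} (hL : L ≠ 0) (f : ℝ → ℝ) :
    Function.Antiperiodic (antiExt L f) L := by
  intro u
  have h : ⌊(u + L) / L⌋ = ⌊u / L⌋ + 1 := by
    rw [add_div, div_self hL, Int.floor_add_one]
  unfold antiExt
  rw [h, zpow_add₀ (by norm_num), Int.cast_add, Int.cast_one,
    show u + L - (⌊u / L⌋ + 1) * L = u - ⌊u / L⌋ * L by ring]
  ring

lemma measurable_antiExt (L : ℝ) {f : ℝ → ℝ} (hf : Measurable f) : Measurable (antiExt L f) := by
  have h : Measurable fun u : ℝ => ⌊u / L⌋ := Int.measurable_floor.comp (measurable_id.div_const L)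
  have h1 : Measurable fun n : ℤ => ((-1 : ℝ)) ^ n := measurable_from_top
  have h2 : Measurable fun n : ℤ => (n : ℝ) := measurable_from_top
  exact (h1.comp h).mul (hf.comp (measurable_id.sub ((h2.comp h).mul_const L)))

lemma antiExt_of_mem_Ico {L : ℝ} (f : ℝ → ℝ) {u : ℝ} (hu : u ∈ Set.Ico 0 L) :
    antiExt L f u = f u := by
  have hL : 0 < L := hu.1.trans_lt hu.2
  have h : ⌊u / L⌋ = 0 := by
    rw [Int.floor_eq_zero_iff]
    exact ⟨div_nonneg hu.1 hL.le, (div_lt_one hL).2 hu.2⟩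
  simp [antiExt, h]

lemma antiExt_ae_restrict (L : ℝ) (f : ℝ → ℝ) :
    antiExt L f =ᵐ[volume.restrict (Set.Icc 0 L)] f := by
  rw [restrict_Ico_eq_restrict_Icc.symm]
  exact (ae_restrict_mem measurableSet_Ico).mono fun u hu => antiExt_of_mem_Ico f hu

lemma Antiperiodic.add_int_mul {f : ℝ → ℝ} {L : ℝ} (hf : Function.Antiperiodic f L) (n : ℤ)
    (x : ℝ) : f (x + n * L) = (-1) ^ n * f x := by
  rw [hf.add_int_mul_eq]
  rcases Int.even_or_odd n with h | h
  · simp [Int.negOnePow_even _ h, h.neg_one_zpow]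
  · simp [Int.negOnePow_odd _ h, h.neg_one_zpow]

lemma Antiperiodic.add_odd {f : ℝ → ℝ} {L : ℝ} (hf : Function.Antiperiodic f L) {n : ℤ}
    (hn : Odd n) (x : ℝ) : f (x + n * L) = -f x := by
  rw [Antiperiodic.add_int_mul hf, hn.neg_one_zpow, neg_one_mul]

lemma Antiperiodic.add_even {f : ℝ → ℝ} {L : ℝ} (hf : Function.Antiperiodic f L) {n : ℤ}
    (hn : Even n) (x : ℝ) : f (x + n * L) = f x := by
  rw [Antiperiodic.add_int_mul hf, hn.neg_one_zpow, one_mul]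

lemma Antiperiodic.ae_eq {f g : ℝ → ℝ} {L : ℝ} (hL : 0 < L) (hf : Function.Antiperiodic f L)
    (hg : Function.Antiperiodic g L) (h : f =ᵐ[volume.restrict (Set.Icc 0 L)] g) :
    f =ᵐ[volume] g := by
  rw [restrict_Ioc_eq_restrict_Icc.symm] at h
  refine ae_of_ae_restrict_period hL (fun x => ?_) 0 (by rwa [zero_add])
  rw [hf, hg, neg_inj]

/-- There are only countably many multiples of `L`, so off a single null set the relation holds
along the whole orbit `u + ℤ L`, and `f u` is determined by its translate in `[0, L)`. This upgrades
almost everywhere antiperiodicity to the pointwise kind that `IsTheta` asks for. -/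
lemma antiExt_ae_eq {f : ℝ → ℝ} {L : ℝ} (h : ∀ᵐ u, f (u + L) = -f u) :
    antiExt L f =ᵐ[volume] f := by
  have h1 : ∀ᵐ u, ∀ n : ℤ, f (u + n * L + L) = -f (u + n * L) :=
    ae_all_iff.2 fun n =>
      (measurePreserving_add_right volume ((n : ℝ) * L)).quasiMeasurePreserving.ae h
  filter_upwards [h1] with u hu
  have h2 : ∀ n : ℤ, f (u + n * L) = (-1) ^ n * f u := by
    intro n
    induction n using Int.induction_on with
    | zero => simp
    | succ k ih =>
      have := hu k
      rw [ih, show u + (k : ℤ) * L + L = u + ((k + 1 : ℤ) : ℝ) * L by push_cast; ring] at this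
      rw [this, zpow_add₀ (by norm_num), zpow_one]
      ring
    | pred k ih =>
      have := hu (-k - 1)
      rw [show u + ((-k - 1 : ℤ) : ℝ) * L + L = u + ((-k : ℤ) : ℝ) * L by push_cast; ring, ih]
        at this
      rw [zpow_sub₀ (by norm_num), zpow_one, div_neg, div_one, neg_mul, this, neg_neg]
  have h3 := h2 (-⌊u / L⌋)
  rw [antiExt, show u - ⌊u / L⌋ * L = u + ((-⌊u / L⌋ : ℤ) : ℝ) * L by push_cast; ring, h3,
    ← mul_assoc, ← zpow_add₀ (by norm_num), add_neg_cancel, zpow_zero, one_mul]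

/-- An antiperiodic function that is square integrable over an antiperiod can be made measurable. -/
lemma IsTheta.exists_measurable {L : ℝ} (hL : 0 < L) {ϑ : ℝ → ℝ} (h : IsTheta L ϑ) :
    ∃ ϑ' : ℝ → ℝ, Measurable ϑ' ∧ IsTheta L ϑ' ∧ ϑ' =ᵐ[volume] ϑ := by
  have hm := h.2.aestronglyMeasurable
  have h1 := (antiExt_ae_restrict L (hm.mk ϑ)).trans hm.ae_eq_mk.symm
  have h2 := antiExt_antiperiodic hL.ne' (hm.mk ϑ)
  exact ⟨_, measurable_antiExt L hm.stronglyMeasurable_mk.measurable,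
    ⟨h2, h.2.ae_eq h1.symm⟩, Antiperiodic.ae_eq hL h2 h.1 h1⟩

/-! ### Square integrals over a period -/

/-- The square `(0, 2π] × (0, 2π]`. -/
def box : Set (ℝ × ℝ) := Set.Ioc 0 (2 * Real.pi) ×ˢ Set.Ioc 0 (2 * Real.pi)

lemma restrict_box : (volume.restrict box : Measure (ℝ × ℝ)) =
    (volume.restrict (Set.Ioc 0 (2 * Real.pi))).prod
      (volume.restrict (Set.Ioc 0 (2 * Real.pi))) := by
  rw [Measure.prod_restrict]; rfl

section Square

variable {L a b : ℝ} {B : ℤ} {ϑ : ℝ → ℝ}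

lemma Antiperiodic.sq_periodic (h : Function.Antiperiodic ϑ L) :
    Function.Periodic (fun u => ϑ u ^ 2) L := fun u => by simp only [h u, neg_sq]

lemma intervalIntegrable_comp_affine_iff {g : ℝ → ℝ} (hb : b ≠ 0) (s t d : ℝ) :
    IntervalIntegrable (fun x => g (d + b * x)) volume s t ↔
      IntervalIntegrable g volume (d + b * s) (d + b * t) := by
  have key : ∀ (g : ℝ → ℝ) (b d s t : ℝ), b ≠ 0 →
      IntervalIntegrable g volume (d + b * s) (d + b * t) →
      IntervalIntegrable (fun x => g (d + b * x)) volume s t := by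
    intro g b d s t hb h
    have := (h.comp_add_left d).comp_mul_left (c := b)
    convert this using 1 <;> field_simp <;> ring
  refine ⟨fun h => ?_, key g b d s t hb⟩
  have := key (fun x => g (d + b * x)) b⁻¹ (-d / b) (d + b * s) (d + b * t) (inv_ne_zero hb)
    (by convert h using 1 <;> field_simp <;> ring)
  convert this using 2
  congr 1
  field_simp
  ring

lemma integrableOn_period_iff (hb : b ≠ 0) (hL : 0 < L) (hB : 2 * Real.pi * b = B * L)
    {g : ℝ → ℝ} (hg : Function.Periodic g L) (d : ℝ) :
    Integrable (fun x => g (d + b * x)) (volume.restrict (Set.Ioc 0 (2 * Real.pi))) ↔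
      IntervalIntegrable g volume 0 L := by
  have hpi := Real.two_pi_pos
  have hBL : (B : ℝ) * L ≠ 0 := hB ▸ mul_ne_zero hpi.ne' hb
  rw [← IntegrableOn, ← intervalIntegrable_iff_integrableOn_Ioc_of_le hpi.le,
    intervalIntegrable_comp_affine_iff hb, mul_zero, add_zero, mul_comm b, hB]
  exact ⟨fun h => (hg.int_mul B).intervalIntegrable hBL h 0 L,
    fun h => hg.intervalIntegrable₀ hL.ne' h _ _⟩

/-- As `x` runs through a circle, `b x` runs through `B` periods, and `B / b = 2π / L` by `hB`. The
formula also covers negative `b`, where `B` is negative too. -/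
lemma integral_period (hb : b ≠ 0) (hL : 0 < L) (hB : 2 * Real.pi * b = B * L)
    {g : ℝ → ℝ} (hg : Function.Periodic g L) (hi : IntervalIntegrable g volume 0 L) (d : ℝ) :
    ∫ x in Set.Ioc 0 (2 * Real.pi), g (d + b * x) = 2 * Real.pi / L * ∫ x in (0 : ℝ)..L, g x := by
  have hpi := Real.two_pi_pos
  have hi' := hg.intervalIntegrable₀ hL.ne' hi
  rw [← intervalIntegral.integral_of_le hpi.le]
  simp_rw [add_comm d]
  rw [intervalIntegral.integral_comp_mul_add _ hb, mul_zero, zero_add, mul_comm b, hB, add_comm,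
    ← zsmul_eq_mul, hg.intervalIntegral_add_zsmul_eq _ _ hi', hg.intervalIntegral_add_eq d 0,
    zero_add, zsmul_eq_mul, smul_eq_mul, ← mul_assoc]
  congr 1
  field_simp
  linear_combination -hB

lemma memLp_iff_intervalIntegrable (hL : 0 < L) (hm : Measurable ϑ) :
    MemLp ϑ 2 (volume.restrict (Set.Icc 0 L)) ↔
      IntervalIntegrable (fun u => ϑ u ^ 2) volume 0 L := by
  rw [memLp_two_iff_integrable_sq hm.aestronglyMeasurable,
    intervalIntegrable_iff_integrableOn_Icc_of_le hL.le, IntegrableOn]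

lemma memLp_box_iff (hb : b ≠ 0) (hL : 0 < L) (hB : 2 * Real.pi * b = B * L) (hm : Measurable ϑ)
    (hϑ : Function.Antiperiodic ϑ L) :
    MemLp (fun z : ℝ × ℝ => ϑ (a * z.1 + b * z.2)) 2 (volume.restrict box) ↔ IsTheta L ϑ := by
  have hper := Antiperiodic.sq_periodic hϑ
  -- Needed to extract an actual slice from an almost everywhere statement: integrability of one
  -- generic slice already gives integrability over a period.
  have hne : NeZero (volume.restrict (Set.Ioc 0 (2 * Real.pi))) := by
    refine ⟨fun h => ?_⟩
    rw [Measure.restrict_eq_zero, Real.volume_Ioc, ENNReal.ofReal_eq_zero] at h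
    linarith [Real.two_pi_pos]
  rw [memLp_two_iff_integrable_sq (Measurable.aestronglyMeasurable (by fun_prop)), IsTheta, and_iff_right hϑ,
    memLp_iff_intervalIntegrable hL hm, restrict_box]
  constructor
  · intro h
    obtain ⟨x, hx⟩ := h.prod_right_ae.exists
    exact (integrableOn_period_iff hb hL hB hper (a * x)).1 hx
  · intro h
    refine (integrable_prod_iff (Measurable.aestronglyMeasurable (by fun_prop))).2
      ⟨Filter.Eventually.of_forall fun x =>
      (integrableOn_period_iff hb hL hB hper (a * x)).2 h, ?_⟩
    simp only [Real.norm_eq_abs, abs_sq]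
    simp_rw [integral_period hb hL hB hper h]
    exact integrable_const _

lemma integral_box_sq (hb : b ≠ 0) (hL : 0 < L) (hB : 2 * Real.pi * b = B * L) (hm : Measurable ϑ)
    (hϑ : IsTheta L ϑ) :
    ∫ z in box, ϑ (a * z.1 + b * z.2) ^ 2 =
      (2 * Real.pi) ^ 2 / L * ∫ u in Set.Icc 0 L, ϑ u ^ 2 := by
  have hper := Antiperiodic.sq_periodic hϑ.1
  have hi := (memLp_iff_intervalIntegrable hL hm).1 hϑ.2
  have hI : Integrable (fun z : ℝ × ℝ => ϑ (a * z.1 + b * z.2) ^ 2) (volume.restrict box) :=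
    ((memLp_box_iff hb hL hB hm hϑ.1).2 hϑ).integrable_sq
  rw [restrict_box] at hI ⊢
  rw [integral_prod _ hI]
  simp_rw [integral_period hb hL hB hper hi]
  rw [integral_Icc_eq_integral_Ioc, ← intervalIntegral.integral_of_le hL.le]
  simp
  rw [max_eq_left Real.two_pi_pos.le]
  ring

end Square

/-! ### Angular coordinates -/

lemma angPt_periodic : Function.Periodic angPt (2 * Real.pi) := by
  intro ρ
  have h : (ρ + 2 * Real.pi) / 2 = ρ / 2 + Real.pi := by ring
  simp only [angPt, h, Real.sin_add_pi, neg_eq_zero, Real.cot_eq_cos_div_sin, Real.cos_add_pi,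
    neg_div_neg_eq]

/-- The angular coordinate in `[0, 2π)`. -/
def ang (x : P1) : ℝ := x.elim 0 fun x : ℝ => 2 * (Real.pi / 2 - Real.arctan x)

lemma measurable_ang : Measurable ang :=
  measurable_of_coe (((measurable_const.sub Real.measurable_arctan)).const_mul 2)

lemma ang_angPt {ρ : ℝ} (h0 : 0 ≤ ρ) (h1 : ρ < 2 * Real.pi) : ang (angPt ρ) = ρ := by
  rcases h0.eq_or_lt with rfl | h0
  · simp [angPt, ang]
  · have hs : Real.sin (ρ / 2) ≠ 0 :=
      (Real.sin_pos_of_pos_of_lt_pi (by linarith) (by linarith)).ne'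
    have ht : Real.cot (ρ / 2) = Real.tan (Real.pi / 2 - ρ / 2) := by
      rw [Real.tan_pi_div_two_sub, Real.cot_eq_cos_div_sin, Real.tan_eq_sin_div_cos, inv_div]
    rw [angPt, if_neg hs, ang, OnePoint.elim_some, ht,
      Real.arctan_tan (by linarith) (by linarith)]
    ring

lemma exists_ang_angPt (ρ : ℝ) : ∃ n : ℤ, ang (angPt ρ) = ρ + n * (2 * Real.pi) := by
  have hpi := Real.two_pi_pos
  refine ⟨-⌊ρ / (2 * Real.pi)⌋, ?_⟩
  have h := Int.floor_le (ρ / (2 * Real.pi))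
  have h' := Int.lt_floor_add_one (ρ / (2 * Real.pi))
  rw [le_div_iff₀ hpi] at h
  rw [div_lt_iff₀ hpi] at h'
  rw [← (angPt_periodic.int_mul (-⌊ρ / (2 * Real.pi)⌋)) ρ]
  apply ang_angPt <;> push_cast <;> linarith

/-- A measurable function of the angular coordinates that is `2π`-periodic in each of them comes
from a measurable function on the torus. -/
lemma exists_torus_of_periodic {Ψ : ℝ × ℝ → ℝ} (hm : Measurable Ψ)
    (h : ∀ (z : ℝ × ℝ) (k l : ℤ), Ψ (z + (k * (2 * Real.pi), l * (2 * Real.pi))) = Ψ z) :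
    ∃ φ : Torus → ℝ, Measurable φ ∧ ∀ z, φ (torusPt z) = Ψ z := by
  refine ⟨fun t => Ψ (ang t.1, ang t.2), hm.comp ((measurable_ang.comp measurable_fst).prodMk
    (measurable_ang.comp measurable_snd)), fun z => ?_⟩
  obtain ⟨k, hk⟩ := exists_ang_angPt z.1
  obtain ⟨l, hl⟩ := exists_ang_angPt z.2
  rw [← h z k l]
  simp only [torusPt, hk, hl]
  rfl

/-! ### Measures in angular coordinates -/

lemma lam_eq_map : lam = (volume.restrict box).map torusPt := by
  rw [restrict_box, lam, lam1, Measure.map_prod_map _ _ measurable_angPt measurable_angPt]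
  rfl

lemma integral_lam {f : Torus → ℝ} (hf : Measurable f) :
    ∫ t, f t ∂lam = ∫ z in box, f (torusPt z) := by
  rw [lam_eq_map, integral_map measurable_torusPt.aemeasurable hf.aestronglyMeasurable]

/-- `lam1` only sees one period of the angle; periodicity of `angPt` spreads the null set over the
whole line. -/
lemma quasiMeasurePreserving_angPt : Measure.QuasiMeasurePreserving angPt volume lam1 := by
  refine ⟨measurable_angPt, Measure.AbsolutelyContinuous.mk fun B hB h => ?_⟩
  rw [Measure.map_apply measurable_angPt hB]
  rw [lam1, Measure.map_apply measurable_angPt hB] at h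
  have h1 : ∀ᵐ ρ, angPt ρ ∉ B := by
    refine ae_of_ae_restrict_period Real.two_pi_pos (fun x => by rw [angPt_periodic]) 0 ?_
    rw [zero_add, ae_iff]
    simp only [not_not]
    exact h
  rw [ae_iff] at h1
  simp only [not_not] at h1
  exact h1

lemma quasiMeasurePreserving_torusPt : Measure.QuasiMeasurePreserving torusPt volume lam :=
  MeasureTheory.QuasiMeasurePreserving.prodMap quasiMeasurePreserving_angPt
    quasiMeasurePreserving_angPt

/-- Almost everywhere on the torus means almost everywhere in the angular coordinates. -/
lemma ae_lam_iff {P : Torus → Prop} (hP : MeasurableSet {t | P t}) :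
    (∀ᵐ t ∂lam, P t) ↔ ∀ᵐ z, P (torusPt z) := by
  refine ⟨quasiMeasurePreserving_torusPt.ae, fun h => ?_⟩
  rw [lam_eq_map, ae_map_iff measurable_torusPt.aemeasurable hP]
  exact ae_restrict_of_ae h

lemma ae_sin_half_ne_zero : ∀ᵐ ρ : ℝ, Real.sin (ρ / 2) ≠ 0 := by
  have h : ∀ᵐ x ∂lam1, x ≠ OnePoint.infty := by
    rw [ae_iff]
    simp only [ne_eq, not_not, Set.ofPred_eq_eq_singleton]
    rw [lam1_null_iff (measurableSet_singleton _)]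
    convert measure_empty (μ := (volume : Measure ℝ))
    ext x
    simp
  filter_upwards [quasiMeasurePreserving_angPt.ae h] with ρ hρ hs
  exact hρ (by rw [angPt, if_pos hs])

/-! ### The sign factor -/

lemma sgnSin_neg (t : ℝ) : sgnSin (-t) = -sgnSin t := by
  simp only [sgnSin, Real.sin_neg, abs_neg, neg_div]

lemma sgnSin_antiperiodic : Function.Antiperiodic sgnSin Real.pi := fun t => by
  simp only [sgnSin, Real.sin_add_pi, abs_neg, neg_div]

lemma measurable_sgnSin : Measurable sgnSin := by
  unfold sgnSin
  fun_prop

lemma sgnSin_sq {t : ℝ} (h : Real.sin t ≠ 0) : sgnSin t ^ 2 = 1 := by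
  rw [sgnSin, div_pow, sq_abs, div_self (pow_ne_zero 2 h)]

/-- The sign `ς(ρ / 2) ς(σ / 2)`. -/
def sgn (z : ℝ × ℝ) : ℝ := sgnSin (z.1 / 2) * sgnSin (z.2 / 2)

lemma measurable_sgn : Measurable sgn :=
  (measurable_sgnSin.comp (measurable_fst.div_const 2)).mul
    (measurable_sgnSin.comp (measurable_snd.div_const 2))

lemma ae_sgn_sq : ∀ᵐ z : ℝ × ℝ, sgn z ^ 2 = 1 := by
  filter_upwards [Measure.quasiMeasurePreserving_fst.ae ae_sin_half_ne_zero,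
    Measure.quasiMeasurePreserving_snd.ae ae_sin_half_ne_zero] with z h1 h2
  rw [sgn, mul_pow, sgnSin_sq h1, sgnSin_sq h2, one_mul]

/-- A full turn of the angle is half a turn of `ρ / 2`, which flips the sign of the sine. This is
the source of all antiperiodicity below. -/
lemma sgn_add (z : ℝ × ℝ) (k l : ℤ) :
    sgn (z + (k * (2 * Real.pi), l * (2 * Real.pi))) = (-1) ^ (k + l) * sgn z := by
  have h : ∀ (x : ℝ) (k : ℤ), sgnSin ((x + k * (2 * Real.pi)) / 2) = (-1) ^ k * sgnSin (x / 2) := by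
    intro x k
    rw [← Antiperiodic.add_int_mul sgnSin_antiperiodic]
    congr 1
    ring
  simp only [sgn, Prod.fst_add, Prod.snd_add, h]
  rw [zpow_add₀ (by norm_num)]
  ring

/-! ### Rotations in angular coordinates -/

lemma cot_mul_sin_add {ρ : ℝ} (h : Real.sin (ρ / 2) ≠ 0) (α : ℝ) :
    Real.cot (ρ / 2) * Real.sin α + Real.cos α =
      Real.sin ((ρ + 2 * α) / 2) / Real.sin (ρ / 2) := by
  rw [show (ρ + 2 * α) / 2 = ρ / 2 + α by ring, Real.sin_add, Real.cot_eq_cos_div_sin]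
  field_simp
  ring

lemma moeb_rot {ρ : ℝ} (h : Real.sin (ρ / 2) ≠ 0) (α : ℝ) :
    moeb (rot α) (angPt ρ) = angPt (ρ + 2 * α) := by
  have h1 := cot_mul_sin_add h α
  rw [angPt, if_neg h, moeb_coe]
  simp only [rot, Matrix.SpecialLinearGroup.coe_mk, Matrix.of_apply, Matrix.cons_val', Matrix.cons_val]
  rw [h1, angPt]
  by_cases h2 : Real.sin ((ρ + 2 * α) / 2) = 0
  · simp [h2]
  · rw [if_neg (div_ne_zero h2 h), if_neg h2]
    congr 1
    rw [Real.cot_eq_cos_div_sin ((ρ + 2 * α) / 2), div_div_eq_mul_div,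
      show (ρ + 2 * α) / 2 = ρ / 2 + α by ring, Real.cos_add, Real.cot_eq_cos_div_sin]
    congr 1
    field_simp
    ring

lemma kFac_rot (α x : ℝ) : kFac (rot α) (x : P1) = 1 := by
  have h : (1 + x ^ 2) ≠ 0 := by positivity
  rw [kFac, OnePoint.elim_some]
  simp only [rot, Matrix.SpecialLinearGroup.coe_mk, Matrix.of_apply, Matrix.cons_val', Matrix.cons_val]
  rw [Real.sqrt_eq_one, div_eq_one_iff_eq h]
  linear_combination (1 + x ^ 2) * Real.sin_sq_add_cos_sq α

lemma sFac_rot {ρ : ℝ} (h : Real.sin (ρ / 2) ≠ 0) (α : ℝ) :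
    sFac (rot α) (angPt ρ) = sgnSin (ρ / 2) * sgnSin ((ρ + 2 * α) / 2) := by
  rw [angPt, if_neg h, sFac, OnePoint.elim_some]
  simp only [rot, Matrix.SpecialLinearGroup.coe_mk, Matrix.of_apply, Matrix.cons_val', Matrix.cons_val]
  rw [cot_mul_sin_add h, abs_div, sgnSin, sgnSin]
  rcases h.lt_or_gt with h | h
  · rw [abs_of_neg h]
    -- At a zero of the translated sine both sides are 0, by the convention for division by zero.
    by_cases h2 : Real.sin ((ρ + 2 * α) / 2) = 0
    · simp [h2]
    · field_simp
  · rw [abs_of_pos h]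
    by_cases h2 : Real.sin ((ρ + 2 * α) / 2) = 0
    · simp [h2]
    · field_simp

lemma dualAct_rot (α β : ℝ) (φ : Torus → ℝ) : ∀ᵐ z : ℝ × ℝ,
    dualAct (rot α, rot β) φ (torusPt z) =
      sgn z * sgn (z + (2 * α, 2 * β)) * φ (torusPt (z + (2 * α, 2 * β))) := by
  filter_upwards [Measure.quasiMeasurePreserving_fst.ae ae_sin_half_ne_zero,
    Measure.quasiMeasurePreserving_snd.ae ae_sin_half_ne_zero] with z h1 h2
  have hk : ∀ (α : ℝ) {ρ : ℝ}, Real.sin (ρ / 2) ≠ 0 → kFac (rot α) (angPt ρ) = 1 := by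
    intro α ρ h
    rw [angPt, if_neg h, kFac_rot]
  simp only [dualAct, torusPt, hk α h1, hk β h2, sFac_rot h1, sFac_rot h2, moeb_rot h1,
    moeb_rot h2, sgn, Prod.fst_add, Prod.snd_add]
  ring

lemma measurable_dualAct (k : GG) {φ : Torus → ℝ} (hφ : Measurable φ) :
    Measurable (dualAct k φ) := by
  have hk : ∀ g, Measurable (kFac g) := fun g => measurable_of_coe (by
    simp only [kFac, OnePoint.elim_some]; fun_prop)
  have hs : ∀ g, Measurable (sFac g) := fun g => measurable_of_coe (by
    simp only [sFac, OnePoint.elim_some]; fun_prop)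
  have := hk k.1
  have := hk k.2
  have := hs k.1
  have := hs k.2
  have := hφ.comp (quasiMeasurePreserving_act k).measurable
  unfold dualAct
  exact (by fun_prop : Measurable fun z : Torus =>
    (kFac k.1 z.1 ^ 3)⁻¹ * sFac k.1 z.1 * ((kFac k.2 z.2 ^ 3)⁻¹ * sFac k.2 z.2)).mul this

/-- The function `φ` in angular coordinates, multiplied by the sign that makes the action of
rotations a translation. -/
def lift (φ : Torus → ℝ) (z : ℝ × ℝ) : ℝ := sgn z * φ (torusPt z)

lemma measurable_lift {φ : Torus → ℝ} (hφ : Measurable φ) : Measurable (lift φ) :=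
  measurable_sgn.mul (hφ.comp measurable_torusPt)

lemma lift_add (φ : Torus → ℝ) (z : ℝ × ℝ) (k l : ℤ) :
    lift φ (z + (k * (2 * Real.pi), l * (2 * Real.pi))) = (-1) ^ (k + l) * lift φ z := by
  have h : torusPt (z + (k * (2 * Real.pi), l * (2 * Real.pi))) = torusPt z := by
    simp only [torusPt, Prod.fst_add, Prod.snd_add]
    rw [angPt_periodic.int_mul k, angPt_periodic.int_mul l]
  rw [lift, lift, sgn_add, h, mul_assoc]

/-- Off a null set `sgn` squares to 1, so the first of the two signs in `dualAct_rot` can be moved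
to the other side, leaving `lift φ` translated and `lift φ` itself. -/
lemma dualAct_rot_ae_eq_iff (α β : ℝ) {φ : Torus → ℝ} (hφ : Measurable φ) :
    dualAct (rot α, rot β) φ =ᵐ[lam] φ ↔ ∀ᵐ z, lift φ (z + (2 * α, 2 * β)) = lift φ z := by
  rw [Filter.EventuallyEq, ae_lam_iff (measurableSet_eq_fun (measurable_dualAct _ hφ) hφ)]
  have h1 := dualAct_rot α β φ
  constructor
  · intro h
    filter_upwards [h, h1, ae_sgn_sq] with z hz hz1 hz2
    rw [lift, lift, ← hz, hz1]
    linear_combination (-sgn (z + (2 * α, 2 * β)) * φ (torusPt (z + (2 * α, 2 * β)))) * hz2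
  · intro h
    filter_upwards [h, h1, ae_sgn_sq] with z hz hz1 hz2
    rw [lift, lift] at hz
    rw [hz1]
    linear_combination sgn z * hz + φ (torusPt z) * hz2

lemma mem_fixedSpace_grpH_iff (N : ℕ) (m n : ℤ) (φ : L2Torus) :
    φ ∈ fixedSpace (grpH N m n) ↔ ∀ (θ : ℝ) (j : ℤ), ∀ᵐ z, lift φ (z + (2 * (m * θ),
      2 * (n * θ + 2 * Real.pi / N * j))) = lift φ z := by
  simp_rw [← dualAct_rot_ae_eq_iff _ _ (Lp.stronglyMeasurable φ).measurable]
  constructor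
  · intro h θ j
    exact h _ ⟨θ, j, rfl⟩
  · rintro h _ ⟨θ, j, rfl⟩
    exact h θ j

/-! ### Invariant functions as antiperiodic functions of a linear form -/

/-- The linear form `a ρ + b σ` is constant along the one parameter group of translations
`(m θ, n θ)`, and `L` generates its values on the lattice spanned by `(2π, 0)`, `(0, 2π)` and
`(0, 4π / N)`, with the parities that make antiperiodicity with period `L` consistent. -/
structure Resonant (N : ℕ) (m n : ℤ) (a b L : ℝ) : Prop where
  period_pos : 0 < L
  b_ne_zero : b ≠ 0
  m_ne_zero : (m : ℝ) ≠ 0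
  ker : a * m + b * n = 0
  fst_odd : ∃ A : ℤ, Odd A ∧ 2 * Real.pi * a = A * L
  snd_odd : ∃ B : ℤ, Odd B ∧ 2 * Real.pi * b = B * L
  rot_even : ∃ C : ℤ, Even C ∧ 4 * Real.pi * b / N = C * L
  gen : ∃ k l j : ℤ, Odd (k + l) ∧ 2 * Real.pi * (a * k + b * l + 2 * b / N * j) = L

/-- Almost everywhere `φ = s ς(ρ / 2) ς(σ / 2) ϑ(a ρ + b σ)`. -/
def IsWave (a b s : ℝ) (φ : Torus → ℝ) (ϑ : ℝ → ℝ) : Prop :=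
  ∀ᵐ z : ℝ × ℝ, φ (torusPt z) = s * sgn z * ϑ (a * z.1 + b * z.2)

section Wave

variable {N : ℕ} {m n : ℤ} {a b L s : ℝ} {φ ψ : Torus → ℝ} {ϑ ϑ' : ℝ → ℝ}

lemma IsWave.congr_right (hb : b ≠ 0) (h : IsWave a b s φ ϑ) (he : ϑ =ᵐ[volume] ϑ') :
    IsWave a b s φ ϑ' := by
  filter_upwards [h, (quasiMeasurePreserving_linearForm a hb).ae he] with z h1 h2
  rw [h1, h2]

lemma IsWave.congr_left (h : IsWave a b s φ ϑ) (he : φ =ᵐ[lam] ψ) : IsWave a b s ψ ϑ := by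
  filter_upwards [h, quasiMeasurePreserving_torusPt.ae he] with z h1 h2
  rw [← h1, h2]

lemma IsWave.add (h : IsWave a b s φ ϑ) (h' : IsWave a b s ψ ϑ') :
    IsWave a b s (φ + ψ) (ϑ + ϑ') := by
  filter_upwards [h, h'] with z h1 h2
  simp only [Pi.add_apply, h1, h2]
  ring

lemma IsWave.const_smul (h : IsWave a b s φ ϑ) (c : ℝ) : IsWave a b s (c • φ) (c • ϑ) := by
  filter_upwards [h] with z h1
  simp only [Pi.smul_apply, smul_eq_mul, h1]
  ring

lemma isWave_iff_lift :
    IsWave a b s φ ϑ ↔ ∀ᵐ z : ℝ × ℝ, lift φ z = s * ϑ (a * z.1 + b * z.2) := by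
  constructor
  · intro h
    filter_upwards [h, ae_sgn_sq] with z h1 h2
    rw [lift, h1]
    linear_combination s * ϑ (a * z.1 + b * z.2) * h2
  · intro h
    filter_upwards [h, ae_sgn_sq] with z h1 h2
    rw [mul_right_comm, ← h1, lift]
    linear_combination -φ (torusPt z) * h2

lemma IsWave.ae_eq (hφ : Measurable φ) (hψ : Measurable ψ) (h : IsWave a b s φ ϑ)
    (h' : IsWave a b s ψ ϑ) : φ =ᵐ[lam] ψ := by
  refine (ae_lam_iff (measurableSet_eq_fun hφ hψ)).2 ?_
  filter_upwards [h, h'] with z h1 h2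
  rw [h1, h2]

/-- The `θ`-part of a translation leaves the form unchanged by `ker`, and the `j`-part moves it by
an even multiple of `L`, which `ϑ` does not notice. -/
lemma IsWave.mem_fixedSpace (hR : Resonant N m n a b L) {φ : L2Torus}
    (hϑ : Function.Antiperiodic ϑ L) (h : IsWave a b s φ ϑ) : φ ∈ fixedSpace (grpH N m n) := by
  rw [isWave_iff_lift] at h
  obtain ⟨C, hC, hCL⟩ := hR.rot_even
  rw [mem_fixedSpace_grpH_iff]
  intro θ j
  filter_upwards [h, ae_shift h (2 * (m * θ), 2 * (n * θ + 2 * Real.pi / N * j))] with z h1 h2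
  rw [h1, h2, Prod.fst_add, Prod.snd_add, ← Antiperiodic.add_even hϑ (hC.mul_right j) (a * z.1 + b * z.2)]
  congr 2
  push_cast
  linear_combination 2 * θ * hR.ker + j * hCL

/-- The factors `s` and `sgn` have absolute value 1 almost everywhere, so only the size of `ϑ` along
the form matters, and `memLp_box_iff` applies. -/
lemma IsWave.isTheta_iff (hR : Resonant N m n a b L) (hs : s ^ 2 = 1) (hφ : Measurable φ)
    (hm : Measurable ϑ) (hϑ : Function.Antiperiodic ϑ L) (h : IsWave a b s φ ϑ) :
    MemLp φ 2 lam ↔ IsTheta L ϑ := by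
  obtain ⟨B, -, hB⟩ := hR.snd_odd
  rw [← memLp_box_iff (a := a) hR.b_ne_zero hR.period_pos hB hm hϑ, lam_eq_map,
    memLp_map_measure_iff hφ.aestronglyMeasurable measurable_torusPt.aemeasurable]
  refine memLp_congr_norm (hφ.comp measurable_torusPt).aestronglyMeasurable
    (Measurable.aestronglyMeasurable (by fun_prop)) ?_
  refine ae_restrict_of_ae ?_
  filter_upwards [h, ae_sgn_sq] with z h1 h2
  have hs1 : ‖s‖ = 1 := (pow_eq_one_iff_of_nonneg (norm_nonneg s) two_ne_zero).1 (by simp [hs])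
  have hs2 : ‖sgn z‖ = 1 := (pow_eq_one_iff_of_nonneg (norm_nonneg (sgn z)) two_ne_zero).1
    (by simp [h2])
  rw [Function.comp_apply, h1, norm_mul, norm_mul, hs1, hs2, one_mul, one_mul]

lemma exists_isWave_of_mem_fixedSpace (hR : Resonant N m n a b L) (hs : s ^ 2 = 1) {φ : L2Torus}
    (h : φ ∈ fixedSpace (grpH N m n)) : ∃ ϑ : ℝ → ℝ, IsTheta L ϑ ∧ IsWave a b s φ ϑ := by
  have hφ := (Lp.stronglyMeasurable φ).measurable
  rw [mem_fixedSpace_grpH_iff] at h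
  obtain ⟨Θ, hΘ, hΘe⟩ := exists_linearForm_of_translation_invariant (measurable_lift hφ)
    hR.b_ne_zero hR.m_ne_zero hR.ker (fun t => by
      -- The half compensates for `rot α` translating the angle by `2α`.
      filter_upwards [h (t / 2) 0] with z hz
      convert hz using 3
      simp only [Int.cast_zero, mul_zero, add_zero, Prod.mk.injEq]
      constructor <;> ring)
  obtain ⟨k, l, j, hkl, hL⟩ := hR.gen
  have hanti : ∀ᵐ u, Θ (u + L) = -Θ u := by
    refine ae_of_ae_linearForm (a := a) hR.b_ne_zero ?_
    -- Translating by `w` together with the `j`-th finite rotation moves the form by exactly `L`;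
    -- the rotation preserves `lift φ`, and `w` contributes the sign `(-1) ^ (k + l) = -1`.
    set w : ℝ × ℝ := (k * (2 * Real.pi), l * (2 * Real.pi)) with hw
    have h1 := h 0 j
    filter_upwards [hΘe, ae_shift h1 w, ae_shift (ae_shift hΘe
      (2 * (m * 0), 2 * (n * 0 + 2 * Real.pi / N * j))) w] with z hz hz1 hz2
    rw [hz1, hw, lift_add, hkl.neg_one_zpow, hz] at hz2
    rw [← neg_one_mul, hz2]
    congr 1
    simp only [Prod.fst_add, Prod.snd_add]
    linear_combination -hL
  have hw : IsWave a b s φ (antiExt L fun u => s * Θ u) := by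
    refine IsWave.congr_right (ϑ := fun u => s * Θ u) hR.b_ne_zero ?_ (antiExt_ae_eq ?_).symm
    · rw [isWave_iff_lift]
      filter_upwards [hΘe] with z hz
      rw [hz]
      linear_combination -Θ (a * z.1 + b * z.2) * hs
    · filter_upwards [hanti] with u hu
      rw [hu, mul_neg]
  exact ⟨_, (hw.isTheta_iff hR hs hφ (measurable_antiExt L (hΘ.const_mul s))
    (antiExt_antiperiodic hR.period_pos.ne' _)).1 (Lp.memLp φ), hw⟩

lemma exists_isWave_of_isTheta (hR : Resonant N m n a b L) (hs : s ^ 2 = 1) (hϑ : IsTheta L ϑ) :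
    ∃ φ : L2Torus, IsWave a b s φ ϑ := by
  obtain ⟨ϑ', hm, hϑ', he⟩ := hϑ.exists_measurable hR.period_pos
  obtain ⟨A, hA, hAL⟩ := hR.fst_odd
  obtain ⟨B, hB, hBL⟩ := hR.snd_odd
  obtain ⟨φ, hφ, h⟩ := exists_torus_of_periodic
    (Ψ := fun z => s * sgn z * ϑ' (a * z.1 + b * z.2))
    ((measurable_sgn.const_mul s).mul (by fun_prop)) (by
      intro z k l
      have h1 : a * (z.1 + k * (2 * Real.pi)) + b * (z.2 + l * (2 * Real.pi)) =
          a * z.1 + b * z.2 + (k * A + l * B : ℤ) * L := by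
        push_cast
        linear_combination k * hAL + l * hBL
      -- Since `A` and `B` are odd, the sign produced by `ϑ'` equals the one produced by `sgn`, and
      -- their product is periodic in each angle.
      have h2 : Even (k * A + l * B) ↔ Even (k + l) := by
        simp only [Int.even_add, Int.even_mul, Int.not_even_iff_odd.2 hA,
          Int.not_even_iff_odd.2 hB, or_false]
      rw [sgn_add, Prod.fst_add, Prod.snd_add, h1]
      rcases Int.even_or_odd (k + l) with h | h
      · rw [Antiperiodic.add_even hϑ'.1 (h2.2 h), h.neg_one_zpow, one_mul]
      · rw [Antiperiodic.add_odd hϑ'.1 (Int.not_even_iff_odd.1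
          (h2.not.2 (Int.not_even_iff_odd.2 h))), h.neg_one_zpow]
        ring)
  have hw : IsWave a b s φ ϑ' := Filter.Eventually.of_forall h
  have hL2 := (hw.isTheta_iff hR hs hφ hm hϑ'.1).2 hϑ'
  exact ⟨hL2.toLp φ, (hw.congr_left hL2.coeFn_toLp.symm).congr_right hR.b_ne_zero he⟩

lemma IsWave.norm_sq (hR : Resonant N m n a b L) (hs : s ^ 2 = 1) {φ : L2Torus}
    (hϑ : IsTheta L ϑ) (h : IsWave a b s φ ϑ) :
    ‖φ‖ ^ 2 = (2 * Real.pi) ^ 2 / L * ∫ u in Set.Icc 0 L, ϑ u ^ 2 := by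
  obtain ⟨B, -, hB⟩ := hR.snd_odd
  obtain ⟨ϑ', hm, hϑ', he⟩ := hϑ.exists_measurable hR.period_pos
  have h' := h.congr_right hR.b_ne_zero he.symm
  have h1 : ∫ u in Set.Icc 0 L, ϑ u ^ 2 = ∫ u in Set.Icc 0 L, ϑ' u ^ 2 := by
    refine integral_congr_ae (ae_restrict_of_ae ?_)
    filter_upwards [he] with u hu
    rw [hu]
  rw [h1, ← integral_box_sq (a := a) hR.b_ne_zero hR.period_pos hB hm hϑ',
    ← real_inner_self_eq_norm_sq, L2.inner_def, integral_lam]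
  · refine integral_congr_ae (ae_restrict_of_ae ?_)
    filter_upwards [h', ae_sgn_sq] with z hz hz1
    simp only [inner_self_eq_norm_sq_to_K, Real.norm_eq_abs, hz]
    simp only [RCLike.ofReal_real_eq_id, id, sq_abs, mul_pow, hs, hz1, one_mul]
  · have hφ := (Lp.stronglyMeasurable φ).measurable
    exact hφ.inner hφ

end Wave

/-! ### The isometry with the square integrable functions on an arc -/

section Isometry

variable {N : ℕ} {m n : ℤ} {a b L s c : ℝ} {γ : ℝ → Torus}

lemma IsTheta.add {ϑ ϑ' : ℝ → ℝ} (h : IsTheta L ϑ) (h' : IsTheta L ϑ') : IsTheta L (ϑ + ϑ') := by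
  refine ⟨fun u => ?_, h.2.add h'.2⟩
  simp only [Pi.add_apply, h.1 u, h'.1 u]
  ring

lemma IsTheta.const_smul {ϑ : ℝ → ℝ} (h : IsTheta L ϑ) (c : ℝ) : IsTheta L (c • ϑ) := by
  refine ⟨fun u => ?_, h.2.const_smul c⟩
  simp only [Pi.smul_apply, h.1 u, smul_neg]

/-- The invariant function `φ` is `c ε ϑ(a ρ + b σ)`, where `ϑ` is the antiperiodic extension of the
function `f` on the arc `γ`. -/
def IsArcWave (a b L s c : ℝ) (γ : ℝ → Torus) (f φ : Torus → ℝ) : Prop :=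
  ∃ ϑ : ℝ → ℝ, IsTheta L ϑ ∧ (∀ᵐ u ∂volume.restrict (Set.Icc 0 L), ϑ u = f (γ u)) ∧
    IsWave a b s φ (c • ϑ)

/-- The measure along the arc `γ` with parameter in `[0, L]`. -/
abbrev curveMeasure (γ : ℝ → Torus) (L : ℝ) : Measure Torus :=
  (volume.restrict (Set.Icc 0 L)).map γ

lemma exists_isArcWave (hR : Resonant N m n a b L) (hs : s ^ 2 = 1) (hγ : Measurable γ)
    (f : Lp ℝ 2 (curveMeasure γ L)) :
    ∃ φ : fixedSpace (grpH N m n), IsArcWave a b L s c γ f (φ : L2Torus) := by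
  have hf := (Lp.stronglyMeasurable f).measurable
  have he := antiExt_ae_restrict L fun u => f (γ u)
  have hθ : IsTheta L (antiExt L fun u => f (γ u)) :=
    ⟨antiExt_antiperiodic hR.period_pos.ne' _,
      ((Lp.memLp f).comp_measurePreserving ⟨hγ, rfl⟩).ae_eq he.symm⟩
  obtain ⟨φ, hφ⟩ := exists_isWave_of_isTheta hR hs (hθ.const_smul c)
  exact ⟨⟨φ, hφ.mem_fixedSpace hR (hθ.const_smul c).1⟩, _, hθ, he, hφ⟩

/-- An antiperiodic function is determined almost everywhere by its restriction to `[0, L]`.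
Linearity of the isometry and surjectivity both reduce to this. -/
lemma IsArcWave.unique (hR : Resonant N m n a b L) {f : Torus → ℝ} {φ ψ : L2Torus}
    (h : IsArcWave a b L s c γ f φ) (h' : IsArcWave a b L s c γ f ψ) : φ = ψ := by
  obtain ⟨ϑ, hϑ, he, hw⟩ := h
  obtain ⟨ϑ', hϑ', he', hw'⟩ := h'
  have h1 : ϑ =ᵐ[volume] ϑ' := by
    refine Antiperiodic.ae_eq hR.period_pos hϑ.1 hϑ'.1 ?_
    filter_upwards [he, he'] with u h1 h2
    rw [h1, h2]
  refine Lp.ext (IsWave.ae_eq (Lp.stronglyMeasurable φ).measurable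
    (Lp.stronglyMeasurable ψ).measurable (hw.congr_right hR.b_ne_zero (h1.const_smul c)) hw')

lemma IsArcWave.add (hγ : Measurable γ) {f g : Lp ℝ 2 (curveMeasure γ L)} {φ ψ : L2Torus}
    (h : IsArcWave a b L s c γ f φ) (h' : IsArcWave a b L s c γ g ψ) :
    IsArcWave a b L s c γ (f + g : Lp ℝ 2 (curveMeasure γ L)) (φ + ψ : L2Torus) := by
  obtain ⟨ϑ, hϑ, he, hw⟩ := h
  obtain ⟨ϑ', hϑ', he', hw'⟩ := h'
  refine ⟨ϑ + ϑ', hϑ.add hϑ', ?_, ?_⟩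
  · filter_upwards [he, he', ae_of_ae_map hγ.aemeasurable (Lp.coeFn_add f g)] with u h1 h2 h3
    rw [h3, Pi.add_apply, Pi.add_apply, h1, h2]
  · rw [smul_add]
    exact (hw.add hw').congr_left (Lp.coeFn_add φ ψ).symm

lemma IsArcWave.const_smul (hγ : Measurable γ) {f : Lp ℝ 2 (curveMeasure γ L)} {φ : L2Torus}
    (h : IsArcWave a b L s c γ f φ) (d : ℝ) :
    IsArcWave a b L s c γ (d • f : Lp ℝ 2 (curveMeasure γ L)) (d • φ : L2Torus) := by
  obtain ⟨ϑ, hϑ, he, hw⟩ := h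
  refine ⟨d • ϑ, hϑ.const_smul d, ?_, ?_⟩
  · filter_upwards [he, ae_of_ae_map hγ.aemeasurable (Lp.coeFn_smul d f)] with u h1 h3
    rw [h3, Pi.smul_apply, Pi.smul_apply, h1]
  · rw [smul_comm]
    exact (hw.const_smul d).congr_left (Lp.coeFn_smul d φ).symm

lemma IsArcWave.norm_eq (hR : Resonant N m n a b L) (hs : s ^ 2 = 1) (hγ : Measurable γ)
    (hc : (2 * Real.pi) ^ 2 / L * c ^ 2 = 1) {f : Lp ℝ 2 (curveMeasure γ L)} {φ : L2Torus}
    (h : IsArcWave a b L s c γ f φ) : ‖φ‖ = ‖f‖ := by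
  obtain ⟨ϑ, hϑ, he, hw⟩ := h
  have hf := (Lp.stronglyMeasurable f).measurable
  have h1 : ‖f‖ ^ 2 = ∫ u in Set.Icc 0 L, ϑ u ^ 2 := by
    rw [← real_inner_self_eq_norm_sq, L2.inner_def, integral_map hγ.aemeasurable
      (hf.inner hf).aestronglyMeasurable]
    refine integral_congr_ae ?_
    filter_upwards [he] with u hu
    simp [hu]
  refine (sq_eq_sq₀ (norm_nonneg _) (norm_nonneg _)).1 ?_
  rw [hw.norm_sq hR hs (hϑ.const_smul c), h1]
  have h2 : ∀ u, (c • ϑ) u ^ 2 = c ^ 2 * ϑ u ^ 2 := fun u => mul_pow c (ϑ u) 2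
  simp_rw [h2]
  rw [integral_const_mul, ← mul_assoc, hc, one_mul]

/-- Functions on the arc live on the torus, so the profile `ϑ'` in the variable `u` is transported
there by composing with a measurable left inverse `w` of the parametrization. -/
lemma exists_arc_of_mem_fixedSpace (hR : Resonant N m n a b L) (hs : s ^ 2 = 1)
    (hγ : Measurable γ) {w : Torus → ℝ} (hw : Measurable w) (hwγ : ∀ u ∈ Set.Icc 0 L, w (γ u) = u)
    (hc : c ≠ 0) {φ : L2Torus} (hφ : φ ∈ fixedSpace (grpH N m n)) :
    ∃ f : Lp ℝ 2 (curveMeasure γ L), IsArcWave a b L s c γ f φ := by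
  obtain ⟨ϑ, hϑ, hwave⟩ := exists_isWave_of_mem_fixedSpace hR hs hφ
  obtain ⟨ϑ', hm, hϑ', he⟩ := (hϑ.const_smul c⁻¹).exists_measurable hR.period_pos
  have h1 : ∀ᵐ u ∂volume.restrict (Set.Icc 0 L), (ϑ' ∘ w) (γ u) = ϑ' u := by
    filter_upwards [ae_restrict_mem measurableSet_Icc] with u hu
    rw [Function.comp_apply, hwγ u hu]
  have hL2 : MemLp (ϑ' ∘ w) 2 (curveMeasure γ L) :=
    (memLp_map_measure_iff (hm.comp hw).aestronglyMeasurable hγ.aemeasurable).2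
      (hϑ'.2.ae_eq (h1.mono fun u hu => hu.symm))
  refine ⟨hL2.toLp _, ϑ', hϑ', ?_, hwave.congr_right hR.b_ne_zero ?_⟩
  · filter_upwards [h1, ae_of_ae_map hγ.aemeasurable hL2.coeFn_toLp] with u h1 h2
    rw [h2, h1]
  · filter_upwards [he] with u hu
    rw [Pi.smul_apply, hu, Pi.smul_apply, smul_inv_smul₀ hc]

/-- The square integrable functions on an arc that is a section of the linear form are isometric to
the invariant functions on the torus. -/
lemma exists_arc_isometry (hR : Resonant N m n a b L) (hs : s ^ 2 = 1) (hγ : Measurable γ)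
    {w : Torus → ℝ} (hw : Measurable w) (hwγ : ∀ u ∈ Set.Icc 0 L, w (γ u) = u)
    (hc : (2 * Real.pi) ^ 2 / L * c ^ 2 = 1) :
    ∃ U : Lp ℝ 2 (curveMeasure γ L) ≃ₗᵢ[ℝ] fixedSpace (grpH N m n),
      ∀ f : Lp ℝ 2 (curveMeasure γ L), IsArcWave a b L s c γ f (U f : L2Torus) := by
  choose V hV using exists_isArcWave (c := c) hR hs hγ
  let V' : Lp ℝ 2 (curveMeasure γ L) →ₗᵢ[ℝ] fixedSpace (grpH N m n) :=
    { toFun := V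
      map_add' := fun f g => Subtype.ext ((hV (f + g)).unique hR ((hV f).add hγ (hV g)))
      map_smul' := fun d f => Subtype.ext ((hV (d • f)).unique hR ((hV f).const_smul hγ d))
      norm_map' := fun f => (hV f).norm_eq hR hs hγ hc }
  have hsurj : Function.Surjective V' := by
    intro φ
    have hc0 : c ≠ 0 := by
      rintro rfl
      norm_num at hc
    obtain ⟨f, hf⟩ := exists_arc_of_mem_fixedSpace hR hs hγ hw hwγ hc0 φ.2
    exact ⟨f, Subtype.ext ((hV f).unique hR hf)⟩
  exact ⟨LinearIsometryEquiv.ofSurjective V' hsurj, hV⟩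

/-- The antiperiodic extension of the constant 1 gives an invariant function whose squared norm is
`(2π) ^ 2`. -/
lemma fixedSpace_ne_bot (hR : Resonant N m n a b L) : fixedSpace (grpH N m n) ≠ ⊥ := by
  have hL := hR.period_pos
  have hpi := Real.two_pi_pos
  have he := antiExt_ae_restrict L fun _ => (1 : ℝ)
  have hϑ : IsTheta L (antiExt L fun _ => (1 : ℝ)) :=
    ⟨antiExt_antiperiodic hL.ne' _, (memLp_const 1).ae_eq he.symm⟩
  have h1 : (1 : ℝ) ^ 2 = 1 := one_pow 2
  obtain ⟨φ, hφ⟩ := exists_isWave_of_isTheta hR h1 hϑ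
  intro hbot
  have hmem := hφ.mem_fixedSpace hR hϑ.1
  rw [hbot, Submodule.mem_bot] at hmem
  have hn := hφ.norm_sq hR h1 hϑ
  have h2 : ∫ u in Set.Icc 0 L, antiExt L (fun _ => (1 : ℝ)) u ^ 2 = L := by
    rw [integral_congr_ae (g := fun _ => (1 : ℝ)) (he.mono fun u hu => by simp only [hu, h1])]
    simp [hL.le]
  rw [hmem, norm_zero, h2, div_mul_cancel₀ _ hL.ne'] at hn
  have hlt := pow_pos hpi 2
  rw [← hn] at hlt
  norm_num at hlt

end Isometry

/-! ### The four families -/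

/-- Coprimality of `x` and `y` makes `w` a combination of `x w` and `y w`, and `w` is coprime to `2
c`. -/
lemma exists_bezout {x y w c : ℤ} (hxy : IsCoprime x y) (hwc : IsCoprime w (2 * c)) :
    ∃ k l j : ℤ, x * w * k + y * w * l + 2 * c * j = 1 := by
  obtain ⟨k, l, h⟩ := hxy
  obtain ⟨e, j, h'⟩ := hwc
  exact ⟨e * k, e * l, j, by linear_combination h' + e * w * h⟩

/-- With `2π / t` as the unit of length, the values of the form on the generators become the
integers `A`, `B` and `2 c`, so `Resonant` turns into parity conditions and a Bezout identity. -/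
lemma Resonant.of_int {N : ℕ} (hN : N ≠ 0) {m n A B c : ℤ} {a b t : ℝ} (ht : 0 < t) (hA : Odd A)
    (hB : Odd B) (ha : a * t = A) (hb : b * t = B) (hc : b * t = c * N) (hm : m ≠ 0)
    (hker : a * m + b * n = 0) (hgen : ∃ k l j : ℤ, A * k + B * l + 2 * c * j = 1) :
    Resonant N m n a b (2 * Real.pi / t) := by
  have hN' : (N : ℝ) ≠ 0 := Nat.cast_ne_zero.2 hN
  refine ⟨div_pos Real.two_pi_pos ht, ?_, Int.cast_ne_zero.2 hm, hker, ⟨A, hA, ?_⟩, ⟨B, hB, ?_⟩,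
    ⟨2 * c, even_two_mul c, ?_⟩, ?_⟩
  · rintro rfl
    rw [zero_mul, eq_comm, Int.cast_eq_zero] at hb
    rw [hb] at hB
    exact absurd hB (by decide)
  · rw [← ha]
    field_simp
  · rw [← hb]
    field_simp
  · rw [eq_div_of_mul_eq ht.ne' hc]
    push_cast
    field_simp
    ring
  · obtain ⟨k, l, j, h⟩ := hgen
    refine ⟨k, l, j, ?_, ?_⟩
    · have h1 : Odd (A * k + B * l) := by
        rw [show A * k + B * l = 1 - 2 * (c * j) by linear_combination h]
        exact odd_one.sub_even (even_two_mul _)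
      rw [← Int.not_even_iff_odd] at h1 hA hB ⊢
      simpa [Int.even_add, Int.even_mul, hA, hB] using h1
    · have h' : (A : ℝ) * k + B * l + 2 * c * j = 1 := by exact_mod_cast h
      rw [eq_div_of_mul_eq ht.ne' ha, show 2 * b / N = 2 * c / t by
        rw [eq_div_of_mul_eq ht.ne' hc]; field_simp, eq_div_of_mul_eq ht.ne' hb]
      field_simp
      linear_combination h'

/-- Here `c = q / gcd(N, q)`. The reduced `N / gcd(N, q)` is coprime to `c` after division by the
gcd, and to 2 as a divisor of the odd `N`. -/
lemma exists_reduction {N q : ℕ} (hN : Odd N) :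
    ∃ c : ℤ, (q * (N / N.gcd q : ℕ) : ℤ) = c * N ∧ Odd ((N / N.gcd q : ℕ) : ℤ) ∧
      IsCoprime ((N / N.gcd q : ℕ) : ℤ) (2 * c) := by
  have hg : 0 < N.gcd q := Nat.gcd_pos_of_pos_left _ hN.pos
  have h1 : N.gcd q * (N / N.gcd q) = N := Nat.mul_div_cancel' (Nat.gcd_dvd_left N q)
  have h2 : N.gcd q * (q / N.gcd q) = q := Nat.mul_div_cancel' (Nat.gcd_dvd_right N q)
  have hodd : Odd (N / N.gcd q) := (Nat.odd_mul.1 (h1.symm ▸ hN)).2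
  refine ⟨(q / N.gcd q : ℕ), ?_, by exact_mod_cast hodd, ?_⟩
  · norm_cast
    calc q * (N / N.gcd q) = N.gcd q * (q / N.gcd q) * (N / N.gcd q) := by rw [h2]
      _ = q / N.gcd q * (N.gcd q * (N / N.gcd q)) := by ring
      _ = q / N.gcd q * N := by rw [h1]
  · rw [show (2 : ℤ) = (2 : ℕ) by rfl, ← Nat.cast_mul, Nat.isCoprime_iff_coprime]
    exact Nat.Coprime.mul_right hodd.coprime_two_right (Nat.coprime_div_gcd_div_gcd hg)

lemma exists_resonant {N q p : ℕ} (hN : Odd N) (hq : Odd q) (hp : Odd p) (hqp : Nat.Coprime q p)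
    (i : Fin 4) : ∃ (m n : ℤ) (a b s : ℝ), family N q p i = grpH N m n ∧ s ^ 2 = 1 ∧
      Resonant N m n a b (arcLen N q p i) ∧ (∀ z, uCoord q p i z = a * z.1 + b * z.2) ∧
      ∀ z, signFac i z = s * sgn z := by
  have hq0 : (q : ℝ) ≠ 0 := Nat.cast_ne_zero.2 hq.pos.ne'
  have hqZ : (q : ℤ) ≠ 0 := Nat.cast_ne_zero.2 hq.pos.ne'
  have hpZ : (p : ℤ) ≠ 0 := Nat.cast_ne_zero.2 hp.pos.ne'
  have hqo : Odd (q : ℤ) := by exact_mod_cast hq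
  have hpo : Odd (p : ℤ) := by exact_mod_cast hp
  have hcop : IsCoprime (q : ℤ) p := Nat.isCoprime_iff_coprime.2 hqp
  obtain ⟨c, hc, hod, hcc⟩ := exists_reduction (q := q) hN
  obtain ⟨d, hd, hod', hdd⟩ := exists_reduction (q := p) hN
  have hpos : (0 : ℝ) < q * (N / N.gcd q : ℕ) := mul_pos (by exact_mod_cast hq.pos)
    (by exact_mod_cast (show 0 < N / N.gcd q from Odd.pos (by exact_mod_cast hod)))
  have hpos' : (0 : ℝ) < q * (N / N.gcd p : ℕ) := mul_pos (by exact_mod_cast hq.pos)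
    (by exact_mod_cast (show 0 < N / N.gcd p from Odd.pos (by exact_mod_cast hod')))
  have h0 : arcLen N q p 0 = 2 * Real.pi / (q * (N / N.gcd q : ℕ)) := rfl
  have h1 : arcLen N q p 1 = 2 * Real.pi / (q * (N / N.gcd p : ℕ)) := rfl
  have h2 : arcLen N q p 2 = 2 * Real.pi / (q * (N / N.gcd q : ℕ)) := rfl
  have h3 : arcLen N q p 3 = 2 * Real.pi / (q * (N / N.gcd p : ℕ)) := rfl
  generalize N / N.gcd q = e at *
  generalize N / N.gcd p = f at *
  have hcR : (q * e : ℝ) = c * N := by exact_mod_cast congrArg (Int.cast : ℤ → ℝ) hc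
  have hdR : (p * f : ℝ) = d * N := by exact_mod_cast congrArg (Int.cast : ℤ → ℝ) hd
  have hsn : ∀ x : ℝ, sgnSin (-x / 2) = -sgnSin (x / 2) := fun x => by rw [neg_div, sgnSin_neg]
  fin_cases i
  · refine ⟨q, p, -(p / q : ℝ), 1, -1, rfl, by norm_num, ?_, fun z => ?_, fun z => ?_⟩
    · change Resonant N q p _ _ (arcLen N q p 0)
      rw [h0]
      -- The unit is `t = q e`, so `A = a t` and `B = b t`; the common factor of `A` and `B` is `e`,
      -- which is coprime to `2 c`. The other three cases follow the same pattern, with `f` and `-d`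
      -- replacing `e` and `c` when the form has `σ`-coefficient `-p / q`.
      refine Resonant.of_int (A := -p * e) (B := q * e) (c := c)
        hN.pos.ne' hpos (hpo.neg.mul hod) (hqo.mul hod) ?_ ?_ ?_ hqZ ?_
        (exists_bezout hcop.symm.neg_left hcc)
      · push_cast; field_simp
      · push_cast; ring
      · rw [one_mul, hcR]
      · push_cast; field_simp; ring
    · simp only [uCoord, Fin.zero_eta, Matrix.cons_val]; ring
    · simp only [signFac, Fin.zero_eta, Matrix.cons_val, hsn, sgn]; ring
  · refine ⟨p, q, 1, -(p / q : ℝ), -1, rfl, by norm_num, ?_, fun z => ?_, fun z => ?_⟩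
    · change Resonant N p q _ _ (arcLen N q p 1)
      rw [h1]
      refine Resonant.of_int (A := q * f) (B := -p * f) (c := -d)
        hN.pos.ne' hpos' (hqo.mul hod') (hpo.neg.mul hod') ?_ ?_ ?_ hpZ ?_
        (exists_bezout hcop.neg_right (by rw [mul_neg]; exact hdd.neg_right))
      · push_cast; ring
      · push_cast; field_simp
      · push_cast; rw [neg_mul (d : ℝ), ← hdR]; field_simp
      · push_cast; field_simp; ring
    · simp only [uCoord, Fin.mk_one, Matrix.cons_val]; ring
    · simp only [signFac, Fin.mk_one, Matrix.cons_val, hsn, sgn]; ring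
  · refine ⟨-q, p, (p / q : ℝ), 1, 1, rfl, by norm_num, ?_, fun z => ?_, fun z => ?_⟩
    · change Resonant N (-q) p _ _ (arcLen N q p 2)
      rw [h2]
      refine Resonant.of_int (A := p * e) (B := q * e) (c := c)
        hN.pos.ne' hpos (hpo.mul hod) (hqo.mul hod) ?_ ?_ ?_ (neg_ne_zero.2 hqZ) ?_
        (exists_bezout hcop.symm hcc)
      · push_cast; field_simp
      · push_cast; ring
      · rw [one_mul, hcR]
      · push_cast; field_simp; ring
    · simp only [uCoord, Fin.reduceFinMk, Matrix.cons_val]; ring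
    · simp only [signFac, Fin.reduceFinMk, Matrix.cons_val, sgn]; ring
  · refine ⟨-p, q, -1, -(p / q : ℝ), 1, rfl, by norm_num, ?_, fun z => ?_, fun z => ?_⟩
    · change Resonant N (-p) q _ _ (arcLen N q p 3)
      rw [h3]
      refine Resonant.of_int (A := -q * f) (B := -p * f) (c := -d)
        hN.pos.ne' hpos' (hqo.neg.mul hod') (hpo.neg.mul hod') ?_ ?_ ?_ (neg_ne_zero.2 hpZ) ?_
        (exists_bezout hcop.neg_left.neg_right (by rw [mul_neg]; exact hdd.neg_right))
      · push_cast; ring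
      · push_cast; field_simp
      · push_cast; rw [neg_mul (d : ℝ), ← hdR]; field_simp
      · push_cast; field_simp; ring
    · simp only [uCoord, Fin.reduceFinMk, Matrix.cons_val]; ring
    · simp only [signFac, Fin.reduceFinMk, Matrix.cons_val, sgn]; ring

/-- Reversing the angle is `x ↦ -x`, and `arctan` is odd. The fourth arc needs this, since its `ρ`
decreases along `u`. -/
lemma angPt_neg (ρ : ℝ) :
    ((angPt ρ).elim 0 fun x : ℝ => 2 * (Real.pi / 2 + Real.arctan x)) = ang (angPt (-ρ)) := by
  simp only [angPt, neg_div, Real.sin_neg, neg_eq_zero]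
  split_ifs with h
  · rfl
  · simp only [ang, OnePoint.elim_some]
    rw [Real.cot_eq_cos_div_sin (-(ρ / 2)), Real.sin_neg, Real.cos_neg, div_neg, Real.arctan_neg,
      sub_neg_eq_add, Real.cot_eq_cos_div_sin]

/-- The coordinate `uᵢ` along the arc extends to a measurable function on the torus. -/
lemma exists_arcPt_leftInverse {q p : ℕ} (hq : 0 < q) (hp : 0 < p) (i : Fin 4) :
    ∃ w : Torus → ℝ, Measurable w ∧ ∀ u ∈ Set.Icc 0 (2 * Real.pi), w (arcPt q p i u) = u := by
  set κ : ℝ := 1 + (p / q : ℝ) ^ 2 with hκ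
  have h0 : 0 < κ := by positivity
  -- Strictness matters: on the arc one angle is `u / κ` or `-u / κ`, and `u / κ` must stay below
  -- `2π` even at `u = 2π`, where `ang` would otherwise jump back to 0.
  have h1 : 1 < κ := by
    have : (0 : ℝ) < p / q := div_pos (by exact_mod_cast hp) (by exact_mod_cast hq)
    rw [hκ]
    nlinarith
  have hlt : ∀ u ∈ Set.Icc 0 (2 * Real.pi), ang (angPt (u / κ)) = u / κ := by
    intro u hu
    refine ang_angPt (div_nonneg hu.1 h0.le) ?_
    rw [div_lt_iff₀ h0]
    nlinarith [hu.2, Real.two_pi_pos]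
  have hm1 : Measurable fun t : Torus => κ * ang t.1 :=
    (measurable_ang.comp measurable_fst).const_mul κ
  have hm2 : Measurable fun t : Torus => κ * ang t.2 :=
    (measurable_ang.comp measurable_snd).const_mul κ
  have hm3 : Measurable fun t : Torus =>
      κ * t.1.elim 0 fun x : ℝ => 2 * (Real.pi / 2 + Real.arctan x) := by
    have h : Measurable fun x : P1 =>
        x.elim (0 : ℝ) fun x : ℝ => 2 * (Real.pi / 2 + Real.arctan x) :=
      measurable_of_coe ((measurable_const.add Real.measurable_arctan).const_mul 2)
    exact (h.comp measurable_fst).const_mul κ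
  fin_cases i
  · refine ⟨_, hm2, fun u hu => ?_⟩
    simp only [arcPt, torusPt, arcCoord, Fin.zero_eta, Matrix.cons_val, Prod.map]
    rw [← hκ, hlt u hu, mul_div_cancel₀ _ h0.ne']
  · refine ⟨_, hm1, fun u hu => ?_⟩
    simp only [arcPt, torusPt, arcCoord, Fin.mk_one, Matrix.cons_val, Prod.map]
    rw [← hκ, hlt u hu, mul_div_cancel₀ _ h0.ne']
  · refine ⟨_, hm2, fun u hu => ?_⟩
    simp only [arcPt, torusPt, arcCoord, Fin.reduceFinMk, Matrix.cons_val, Prod.map]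
    rw [← hκ, hlt u hu, mul_div_cancel₀ _ h0.ne']
  · refine ⟨_, hm3, fun u hu => ?_⟩
    simp only [arcPt, torusPt, arcCoord, Fin.reduceFinMk, Matrix.cons_val, Prod.map]
    rw [angPt_neg, ← hκ, neg_div, neg_neg, hlt u hu, mul_div_cancel₀ _ h0.ne']

lemma Nred_pos {N q p : ℕ} (hN : 0 < N) (i : Fin 4) : 0 < Nred N q p i := by
  have h : ∀ q, 0 < N / N.gcd q := fun q =>
    Nat.div_pos (Nat.gcd_le_left q hN) (Nat.gcd_pos_of_pos_left q hN)
  fin_cases i <;> exact h _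

end UHBMS

end

theorem mainTheorem2 (N q p : ℕ) (hN : Odd N) (hq : Odd q) (hp : Odd p) (hqp : Nat.Coprime q p)
    (i : Fin 4) :
    UHBMS.fixedSpace (UHBMS.family N q p i) ≠ ⊥ ∧
    (∀ φ : UHBMS.L2Torus, φ ∈ UHBMS.fixedSpace (UHBMS.family N q p i) ↔
      ∃ ϑ : ℝ → ℝ, UHBMS.IsTheta (UHBMS.arcLen N q p i) ϑ ∧ UHBMS.HasForm q p i φ ϑ) ∧
    (∀ ϑ : ℝ → ℝ, UHBMS.IsTheta (UHBMS.arcLen N q p i) ϑ →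
      ∃ φ : UHBMS.L2Torus, UHBMS.HasForm q p i φ ϑ) ∧
    Set.InjOn (UHBMS.arcPt q p i) (Set.Icc 0 (UHBMS.arcLen N q p i)) ∧
    ∃ U : UHBMS.L2Arc N q p i ≃ₗᵢ[ℝ] UHBMS.fixedSpace (UHBMS.family N q p i),
      ∀ f : UHBMS.L2Arc N q p i, ∃ ϑ : ℝ → ℝ, UHBMS.IsTheta (UHBMS.arcLen N q p i) ϑ ∧
        (∀ᵐ u ∂(MeasureTheory.volume.restrict (Set.Icc 0 (UHBMS.arcLen N q p i))),
          ϑ u = f (UHBMS.arcPt q p i u)) ∧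
        UHBMS.HasForm q p i (U f : UHBMS.L2Torus)
          (fun u => (Real.sqrt (2 * Real.pi * q * UHBMS.Nred N q p i))⁻¹ * ϑ u) := by
  obtain ⟨m, n, a, b, s, hfam, hs, hR, hu, hsgn⟩ := UHBMS.exists_resonant hN hq hp hqp i
  have hform : ∀ φ ϑ, UHBMS.HasForm q p i φ ϑ ↔ UHBMS.IsWave a b s φ ϑ := fun φ ϑ => by
    simp only [UHBMS.HasForm, UHBMS.IsWave, hu, hsgn]
  have hpi := Real.pi_pos
  have hq1 : (1 : ℝ) ≤ q := Nat.one_le_cast.2 hq.pos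
  have hN1 : (1 : ℝ) ≤ UHBMS.Nred N q p i := Nat.one_le_cast.2 (UHBMS.Nred_pos hN.pos i)
  have hqN : (1 : ℝ) ≤ q * UHBMS.Nred N q p i := one_le_mul_of_one_le_of_one_le hq1 hN1
  have hL : UHBMS.arcLen N q p i ≤ 2 * Real.pi := div_le_self Real.two_pi_pos.le hqN
  obtain ⟨w, hw, hwγ⟩ := UHBMS.exists_arcPt_leftInverse hq.pos hp.pos i
  have hwγ' : ∀ u ∈ Set.Icc 0 (UHBMS.arcLen N q p i), w (UHBMS.arcPt q p i u) = u :=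
    fun u hu => hwγ u ⟨hu.1, hu.2.trans hL⟩
  -- The normalizing constant is chosen to cancel the factor `(2π) ^ 2 / L = 2π q N'` from
  -- `IsWave.norm_sq`.
  have hc : (2 * Real.pi) ^ 2 / UHBMS.arcLen N q p i *
      (Real.sqrt (2 * Real.pi * q * UHBMS.Nred N q p i))⁻¹ ^ 2 = 1 := by
    rw [inv_pow, Real.sq_sqrt (by positivity), UHBMS.arcLen]
    field_simp
  rw [hfam]
  simp only [hform]
  refine ⟨UHBMS.fixedSpace_ne_bot hR, fun φ => ⟨UHBMS.exists_isWave_of_mem_fixedSpace hR hs, ?_⟩,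
    fun ϑ => UHBMS.exists_isWave_of_isTheta hR hs,
    fun u hu v hv huv => by rw [← hwγ' u hu, ← hwγ' v hv, huv],
    UHBMS.exists_arc_isometry hR hs (UHBMS.measurable_arcPt q p i) hw hwγ' hc⟩
  rintro ⟨ϑ, hϑ, h⟩
  exact h.mem_fixedSpace hR hϑ.1
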